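/- Let $D$ be an oriented diagram, with at least one crossing, of an oriented knot. Its arcs run from one under-passage to the next. The knot group $G_D$ is given by the Wirtinger presentation of $D$: one generator $w_i$ for each arc, and for each crossing with incoming lower arc $i$, outgoing lower arc $j$, upper arc $k$ and sign $\varepsilon=\pm1$ the relation $w_j = w_k^{-\varepsilon} w_i w_k^{\varepsilon}$. The conjugates of the $w_i$ are the meridians. A homomorphism $\rho\colon G_D\to SL_2(\mathbb C)$ is called parabolic if it is non-abelian and $\operatorname{tr}\rho(m)=2$, $\rho(m)\neq I$ for each meridian $m$. For $v=(x,y)^T\in\mathbb C^2$ put $\mathcal M(v)=\begin{pmatrix}1-xy & x^2\\ -y^2 & 1+xy\end{pmatrix}$. An arc-coloring of $D$ associated with a parabolic representation $\rho$ is a choice of vectors $a_i\in\mathbb C^2$, one for each arc, with $\mathcal M(a_i)=\rho(w_i)$; each $a_i$ exists and is determined up to sign. The $u$-values are $u_{ij}=\det(a_i,a_j)$, and the $u$-field is the subfield $\mathbb Q(\{u_{ij}\})$ of $\mathbb C$ generated by the $u$-values of all pairs of arcs. **Theorem.** Let $D$ and $D'$ be two diagrams of the same oriented knot, that is, diagrams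 on the sphere that are connected by a finite sequence of Reidemeister moves. Then there is an isomorphism $\varphi\colon G_D\to G_{D'}$ induced by Reidemeister moves (composed of isomorphisms for single moves and their inverses, where for a single move the Wirtinger generators of the parts of the diagram outside the move correspond to each other). For every such $\varphi$, every parabolic representation $\rho\colon G_{D'}\to SL_2(\mathbb C)$, every arc-coloring $(a_i)$ of $D$ associated with $\rho\circ\varphi$ and every arc-coloring $(a'_k)$ of $D'$ associated with $\rho$, $$\mathbb Q(\{\det(a_i,a_j)\}_{i,j}) = \mathbb Q(\{\det(a'_k,a'_l)\}_{k,l}).$$ That is, the $u$-field of a parabolic representation depends neither on the diagram nor on the signs of the coloring vectors. -/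

import Mathlib

/-- One passage of an oriented knot diagram through a crossing: the name of the crossing, whether the
knot runs through it on the upper (`upper = true`) or the lower strand, and the sign of the crossing. -/
structure Passage where
  crossing : ℕ
  upper : Bool
  sign : ℤˣ

/-- The cyclic successor on the edges of a Gauss code `w`. Running once around the knot one meets the
passages `w[0], w[1], …`; edge `e` is the piece of the knot that enters the passage `w[e]`, and it is
followed by edge `nextEdge w e`, which leaves that passage. -/
def nextEdge (w : List Passage) : Equiv.Perm (Fin w.length) := finRotate w.length

/-- `w[p]` and `w[q]` are the two passages of one crossing, and there the strand of `q` crosses the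
strand of `p` from right to left. (At a positive crossing the lower strand crosses the upper one from
right to left, at a negative crossing it is the upper one that crosses the lower one so.) -/
def CrossesToLeft (w : List Passage) (p q : Fin w.length) : Prop :=
  (w.get p).crossing = (w.get q).crossing ∧ (w.get p).upper ≠ (w.get q).upper ∧
    ((w.get p).upper = true ↔ (w.get p).sign = 1)

/-- `(e, true)` is the left side and `(e, false)` the right side of the edge `e`. Two sides are
adjacent if they bound one of the four corners at a crossing. -/
inductive Corner (w : List Passage) : Fin w.length × Bool → Fin w.length × Bool → Prop
  | back {p q : Fin w.length} (h : CrossesToLeft w p q) :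
      Corner w (p, true) (nextEdge w q, true)
  | front {p q : Fin w.length} (h : CrossesToLeft w p q) :
      Corner w (nextEdge w p, false) (q, false)
  | outgoing {p q : Fin w.length} (h : CrossesToLeft w p q) :
      Corner w (nextEdge w p, true) (nextEdge w q, false)
  | incoming {p q : Fin w.length} (h : CrossesToLeft w p q) :
      Corner w (p, false) (q, true)

/-- The faces (boundary circuits) of the 4-valent graph that a Gauss code describes. -/
def Face (w : List Passage) : Type := Quot (Corner w)

/-- An oriented knot diagram with at least one crossing, up to isotopy of the sphere, given by its
signed Gauss code. -/
structure KnotDiagram where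
  code : List Passage
  code_ne_nil : code ≠ []
  /-- no crossing is passed twice on the same level -/
  nodup : (code.map fun p => (p.crossing, p.upper)).Nodup
  /-- each crossing is passed on both levels, with one sign -/
  partner_mem : ∀ p ∈ code, (⟨p.crossing, !p.upper, p.sign⟩ : Passage) ∈ code
  /-- The diagram lies on the sphere. There are `code.length / 2` crossings and `code.length` edges,
  and the Euler characteristic is `2`. -/
  planar : 2 * Nat.card (Face code) = code.length + 4

namespace KnotDiagram

/-- The edges of the diagram, cut at every passage. -/
abbrev Edge (D : KnotDiagram) : Type := Fin D.code.length

/-- The arcs of the diagram: the edges, joined at the upper strands of the crossings, so that an arc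
runs from one under-passage to the next. -/
def Arc (D : KnotDiagram) : Type :=
  Quot fun e e' : D.Edge => (D.code.get e).upper = true ∧ e' = nextEdge D.code e

/-- The arc that contains a given edge. -/
def arc (D : KnotDiagram) (e : D.Edge) : D.Arc := Quot.mk _ e

/-- The Wirtinger relators. At a crossing of sign `ε` with incoming lower arc `i`, outgoing lower arc
`j` and upper arc `k`, the relation is `g_j = g_k ^ (-ε) * g_i * g_k ^ ε`. -/
def relators (D : KnotDiagram) : Set (FreeGroup D.Arc) :=
  {r | ∃ e o : D.Edge, (D.code.get e).upper = false ∧ (D.code.get o).upper = true ∧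
    (D.code.get e).crossing = (D.code.get o).crossing ∧
    r = (FreeGroup.of (D.arc (nextEdge D.code e)))⁻¹ *
      FreeGroup.of (D.arc o) ^ (-((D.code.get e).sign : ℤ)) *
      FreeGroup.of (D.arc e) * FreeGroup.of (D.arc o) ^ ((D.code.get e).sign : ℤ)}

/-- The knot group, by its Wirtinger presentation. -/
abbrev KnotGroup (D : KnotDiagram) : Type := PresentedGroup D.relators

/-- The Wirtinger generator of an arc. -/
def gen (D : KnotDiagram) (i : D.Arc) : D.KnotGroup := PresentedGroup.of i

/-- The meridians: the conjugates of the Wirtinger generators. -/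
def IsMeridian (D : KnotDiagram) (m : D.KnotGroup) : Prop := ∃ i : D.Arc, IsConj (D.gen i) m

/-- The Gauss code, where each passage carries the label of the arc that enters it. -/
def labelled (D : KnotDiagram) {X : Type} (f : D.Arc → X) : List (Passage × X) :=
  List.ofFn fun e : D.Edge => (D.code.get e, f (D.arc e))

end KnotDiagram

/-- Two consecutive passages `p`, `q`, in this order if `o = 1` and in the opposite order if `o = -1`;
`x` labels the edge that enters the first one, `y` the edge between them. -/
def strand {X : Type} (o : ℤˣ) (p q : Passage) (x y : X) : List (Passage × X) :=
  if o = 1 then [(p, x), (q, y)] else [(q, x), (p, y)]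

/-- The elementary moves on Gauss codes with labelled edges. Each edge that exists before and after the
move (outside the disc in which the move takes place) keeps its label. -/
inductive ReidemeisterStep {X : Type} : List (Passage × X) → List (Passage × X) → Prop
  /-- Start reading the code elsewhere. -/
  | rotate (u v : List (Passage × X)) : ReidemeisterStep (u ++ v) (v ++ u)
  /-- Rename the crossings. -/
  | rename (f : ℕ → ℕ) (hf : Function.Injective f) (u : List (Passage × X)) :
      ReidemeisterStep u (u.map fun p => (⟨f p.1.crossing, p.1.upper, p.1.sign⟩, p.2))
  /-- First move: insert a kink of either sign, passing first over or first under. -/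
  | first (c : ℕ) (b : Bool) (ε : ℤˣ) (x y : X) (u : List (Passage × X)) :
      ReidemeisterStep u ((⟨c, b, ε⟩, x) :: (⟨c, !b, ε⟩, y) :: u)
  /-- Second move: pull a strand over another one, which creates two crossings of opposite signs. The
  lower strand meets them in the same order (`o = 1`) or in the opposite order (`o = -1`). -/
  | second (c d : ℕ) (ε o : ℤˣ) (x x' y y' : X) (u v : List (Passage × X)) :
      ReidemeisterStep (u ++ v)
        ([(⟨c, true, ε⟩, x), (⟨d, true, -ε⟩, x')] ++ u ++
          strand o ⟨c, false, ε⟩ ⟨d, false, -ε⟩ y y' ++ v)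
  /-- Third move: three strands 1, 2, 3, from top to bottom, cross pairwise and bound a triangle. `a`,
  `b`, `c` are the crossings of 1 with 2, of 1 with 3, of 2 with 3, and `α`, `β`, `γ` are their signs.
  If three oriented straight lines cross with these signs, then the orders of the two crossings on the
  lines 1, 2, 3 are given by `δ * α * β`, `δ * α * γ`, `δ * β * γ`, where `δ` changes when one line is
  moved across the crossing of the other two. Here one meets the strands in the order 1, 2, 3. -/
  | third (a b c : ℕ) (α β γ δ : ℤˣ) (x y y' x₂ y₂ y₂' x₃ y₃ y₃' : X)
      (u v w : List (Passage × X)) :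
      ReidemeisterStep
        (strand (δ * α * β) ⟨a, true, α⟩ ⟨b, true, β⟩ x y ++ u ++
          strand (δ * α * γ) ⟨a, false, α⟩ ⟨c, true, γ⟩ x₂ y₂ ++ v ++
          strand (δ * β * γ) ⟨b, false, β⟩ ⟨c, false, γ⟩ x₃ y₃ ++ w)
        (strand (-δ * α * β) ⟨a, true, α⟩ ⟨b, true, β⟩ x y' ++ u ++
          strand (-δ * α * γ) ⟨a, false, α⟩ ⟨c, true, γ⟩ x₂ y₂' ++ v ++
          strand (-δ * β * γ) ⟨b, false, β⟩ ⟨c, false, γ⟩ x₃ y₃' ++ w)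
  /-- Third move, where one meets the strands in the order 1, 3, 2. -/
  | third' (a b c : ℕ) (α β γ δ : ℤˣ) (x y y' x₂ y₂ y₂' x₃ y₃ y₃' : X)
      (u v w : List (Passage × X)) :
      ReidemeisterStep
        (strand (δ * α * β) ⟨a, true, α⟩ ⟨b, true, β⟩ x y ++ u ++
          strand (δ * β * γ) ⟨b, false, β⟩ ⟨c, false, γ⟩ x₃ y₃ ++ v ++
          strand (δ * α * γ) ⟨a, false, α⟩ ⟨c, true, γ⟩ x₂ y₂ ++ w)
        (strand (-δ * α * β) ⟨a, true, α⟩ ⟨b, true, β⟩ x y' ++ u ++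
          strand (-δ * β * γ) ⟨b, false, β⟩ ⟨c, false, γ⟩ x₃ y₃' ++ v ++
          strand (-δ * α * γ) ⟨a, false, α⟩ ⟨c, true, γ⟩ x₂ y₂' ++ w)

namespace KnotDiagram

/-- Two diagrams represent the same oriented knot: they are connected by a finite sequence of
Reidemeister moves, in either direction, through diagrams on the sphere. -/
def SameKnot : KnotDiagram → KnotDiagram → Prop :=
  Relation.EqvGen fun D D' =>
    ReidemeisterStep (D.labelled fun _ => ()) (D'.labelled fun _ => ())

/-- The isomorphisms between the knot groups read off from two diagrams that come from a sequence of
Reidemeister moves. For a single move, the Wirtinger generators of the edges that the move does not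
touch correspond to each other. -/
inductive IsReidemeisterIso : {D D' : KnotDiagram} → (D.KnotGroup ≃* D'.KnotGroup) → Prop
  | refl (D : KnotDiagram) : IsReidemeisterIso (MulEquiv.refl D.KnotGroup)
  | step {D D' : KnotDiagram} (φ : D.KnotGroup ≃* D'.KnotGroup)
      (h : ReidemeisterStep (D.labelled D.gen) (D'.labelled fun i => φ.symm (D'.gen i))) :
      IsReidemeisterIso φ
  | symm {D D' : KnotDiagram} (φ : D.KnotGroup ≃* D'.KnotGroup) :
      IsReidemeisterIso φ → IsReidemeisterIso φ.symm
  | trans {D D' D'' : KnotDiagram} (φ : D.KnotGroup ≃* D'.KnotGroup)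
      (ψ : D'.KnotGroup ≃* D''.KnotGroup) :
      IsReidemeisterIso φ → IsReidemeisterIso ψ → IsReidemeisterIso (φ.trans ψ)

/-- A representation of the knot group is parabolic if it is non-abelian and the image of every
meridian has trace `2` and is not the identity. -/
def IsParabolic (D : KnotDiagram)
    (ρ : D.KnotGroup →* Matrix.SpecialLinearGroup (Fin 2) ℂ) : Prop :=
  (∃ g h : D.KnotGroup, ρ g * ρ h ≠ ρ h * ρ g) ∧
    ∀ m : D.KnotGroup, D.IsMeridian m →
      Matrix.trace (ρ m : Matrix (Fin 2) (Fin 2) ℂ) = 2 ∧ ρ m ≠ 1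

end KnotDiagram

/-- The parabolic quandle map, from vectors `(x, y)` to matrices of determinant `1` and trace `2`. -/
def parabolicMatrix (v : Fin 2 → ℂ) : Matrix (Fin 2) (Fin 2) ℂ :=
  !![1 - v 0 * v 1, v 0 ^ 2; -v 1 ^ 2, 1 + v 0 * v 1]

namespace KnotDiagram

/-- `a` is an arc-coloring by vectors that is associated with the representation `ρ`. -/
def IsArcColoring (D : KnotDiagram) (ρ : D.KnotGroup →* Matrix.SpecialLinearGroup (Fin 2) ℂ)
    (a : D.Arc → Fin 2 → ℂ) : Prop :=
  ∀ i : D.Arc, parabolicMatrix (a i) = (ρ (D.gen i) : Matrix (Fin 2) (Fin 2) ℂ)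

/-- The `u`-value of a pair of arcs: the determinant of the two coloring vectors, as columns. -/
def uValue (D : KnotDiagram) (a : D.Arc → Fin 2 → ℂ) (i j : D.Arc) : ℂ :=
  Matrix.det !![a i 0, a j 0; a i 1, a j 1]

/-- The `u`-field: the subfield of `ℂ` generated by the `u`-values of all pairs of arcs. -/
noncomputable def uField (D : KnotDiagram) (a : D.Arc → Fin 2 → ℂ) : IntermediateField ℚ ℂ :=
  IntermediateField.adjoin ℚ (Set.range fun ij : D.Arc × D.Arc => D.uValue a ij.1 ij.2)

/-- The coloring vectors of a parabolic representation exist. -/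
theorem IsParabolic.exists_isArcColoring {D : KnotDiagram}
    {ρ : D.KnotGroup →* Matrix.SpecialLinearGroup (Fin 2) ℂ} (hρ : D.IsParabolic ρ) :
    ∃ a : D.Arc → Fin 2 → ℂ, D.IsArcColoring ρ a := by
  suffices h : ∀ i : D.Arc, ∃ v : Fin 2 → ℂ,
      parabolicMatrix v = (ρ (D.gen i) : Matrix (Fin 2) (Fin 2) ℂ) by
    choose a ha using h
    exact ⟨a, ha⟩
  intro i
  have ht := (hρ.2 (D.gen i) ⟨i, IsConj.refl _⟩).1
  have hd := (ρ (D.gen i)).2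
  generalize (ρ (D.gen i) : Matrix (Fin 2) (Fin 2) ℂ) = A at ht hd
  rw [Matrix.trace_fin_two] at ht
  rw [Matrix.det_fin_two] at hd
  obtain ⟨x, hx⟩ := IsAlgClosed.exists_pow_nat_eq (A 0 1) (n := 2) (by norm_num)
  obtain ⟨y, hy⟩ := IsAlgClosed.exists_pow_nat_eq (-A 1 0) (n := 2) (by norm_num)
  have h11 : A 1 1 = 2 - A 0 0 := by linear_combination ht
  have hsq : (x * y) ^ 2 = (1 - A 0 0) ^ 2 := by
    rw [mul_pow, hx, hy]
    rw [h11] at hd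
    linear_combination hd
  have key : ∀ z : ℂ, x * z = 1 - A 0 0 → z ^ 2 = -A 1 0 → parabolicMatrix ![x, z] = A := by
    intro z hz hz2
    ext r s
    fin_cases r <;> fin_cases s <;> simp [parabolicMatrix, hx, hz, hz2, h11]
    ring
  rcases sq_eq_sq_iff_eq_or_eq_neg.mp hsq with h | h
  · exact ⟨_, key y h hy⟩
  · exact ⟨_, key (-y) (by linear_combination -h) (by rw [neg_sq, hy])⟩

end KnotDiagram

/-! The theorem has two halves, joined by the notion of a meridian.

Existence of `φ`: for any group `H`, a homomorphism from the knot group to `H` is the same as a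
labelling of the edges of the Gauss code by elements of `H` that obeys the Wirtinger relations
(`isWirtingerLabelling_labelled`, `exists_hom_of_isWirtingerLabelling`). At each move, a labelling
before the move extends in exactly one way to a labelling after it that agrees outside the move, and
conversely, naturally in `H`. By a Yoneda argument (`exists_isReidemeisterIso_of_transfer`) this
bijection comes from an isomorphism of groups, so each move reduces to a local computation with
labels.

Equality of fields: `parabolicMatrix v` is the transvection `w ↦ w + det(v, w) v`, and conjugating
it by `g` in `SL₂` gives the transvection along `g v`. Applying `ρ` of a generator or of its inverse
thus changes a vector by an arc vector, with a determinant as coefficient. By induction on group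
words every `det(a_i, ρ(g) a_j)` lies in the `u`-field. The vectors that color arbitrary meridians
are, up to sign, the `ρ(g) a_j`, and determinants are `SL₂`-invariant. Hence the `u`-field is
generated by the determinants of all meridian vectors (`IsArcColoring.uField_eq`), a description
that mentions only `ρ` and the set of meridians.

Finally `φ` carries meridians to meridians: in a knot group they form one conjugacy class, and every
move matches at least one generator on each side. -/

/-! ### Wirtinger labellings of lists of passages -/

section Chain

variable {H : Type} [Group H]

/-- The label of the edge that leaves the passage `p`, if `x` labels the edge that enters it and
`lab` gives the labels of the upper strands. -/
def passageLabel (lab : ℕ → H) (p : Passage) (x : H) : H :=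
  if p.upper = true then x
  else lab p.crossing ^ (-(p.sign : ℤ)) * x * lab p.crossing ^ (p.sign : ℤ)

/-- The labels of `L` satisfy the Wirtinger relations with upper labels `lab`; the first edge is
labelled `x`, and `z` is the label of the edge that leaves the last passage. -/
def WirtingerChain (lab : ℕ → H) : H → List (Passage × H) → H → Prop
  | x, [], z => x = z
  | x, q :: L, z => q.2 = x ∧ (q.1.upper = true → lab q.1.crossing = x) ∧
      WirtingerChain lab (passageLabel lab q.1 x) L z

/-- The lists of passages of `w` with labels in a group that satisfy the Wirtinger relations. -/
def IsWirtingerLabelling (w : List Passage) (L : List (Passage × H)) : Prop :=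
  L.map Prod.fst = w ∧ ∃ (lab : ℕ → H) (x : H), WirtingerChain lab x L x

theorem wirtingerChain_append {lab : ℕ → H} {x z : H} {L M : List (Passage × H)} :
    WirtingerChain lab x (L ++ M) z ↔
      ∃ y, WirtingerChain lab x L y ∧ WirtingerChain lab y M z := by
  induction L generalizing x with
  | nil => simp [WirtingerChain]
  | cons q L ih =>
    simp only [List.cons_append, WirtingerChain, ih]
    constructor
    · rintro ⟨h1, h2, y, h3, h4⟩
      exact ⟨y, ⟨h1, h2, h3⟩, h4⟩
    · rintro ⟨y, ⟨h1, h2, h3⟩, h4⟩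
      exact ⟨h1, h2, y, h3, h4⟩

/-- A chain sees `lab` only at the crossings it passes, so a move may assign upper labels freely at
crossings that the rest of the code avoids. -/
theorem WirtingerChain.congr {lab lab' : ℕ → H} {L : List (Passage × H)} {x z : H}
    (h : WirtingerChain lab x L z) (ho : ∀ q ∈ L, lab' q.1.crossing = lab q.1.crossing) :
    WirtingerChain lab' x L z := by
  induction L generalizing x with
  | nil => exact h
  | cons q L ih =>
    obtain ⟨h1, h2, h3⟩ := h
    have hq := ho q (by simp)
    refine ⟨h1, fun hu => by rw [hq, h2 hu], ?_⟩
    have : passageLabel lab' q.1 x = passageLabel lab q.1 x := by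
      simp only [passageLabel, hq]
    rw [this]
    exact ih h3 fun r hr => ho r (by simp [hr])

/-- The label of the edge number `i` of the list `L`, where `z` labels the edge that leaves it. -/
def labelAt (L : List (Passage × H)) (z : H) (i : ℕ) : H := (L[i]?.map Prod.snd).getD z

/-- The recursive form is convenient for cutting codes at a move, the positionwise form for
comparison with the edges of a diagram. The default value `z` of `labelAt` is the label of the edge
after the last passage. -/
theorem wirtingerChain_iff {lab : ℕ → H} {x z : H} {L : List (Passage × H)} :
    WirtingerChain lab x L z ↔ labelAt L z 0 = x ∧ ∀ (i : ℕ) (h : i < L.length),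
      (L[i].1.upper = true → lab L[i].1.crossing = labelAt L z i) ∧
        labelAt L z (i + 1) = passageLabel lab L[i].1 (labelAt L z i) := by
  induction L generalizing x with
  | nil => exact ⟨fun h => ⟨h.symm, fun i hi => absurd hi (by simp)⟩, fun h => h.1.symm⟩
  | cons q L ih =>
    have h0 : labelAt (q :: L) z 0 = q.2 := rfl
    have hs (i : ℕ) : labelAt (q :: L) z (i + 1) = labelAt L z i := rfl
    simp only [WirtingerChain, ih]
    constructor
    · rintro ⟨rfl, h2, h3, h4⟩
      refine ⟨h0, fun i hi => ?_⟩
      cases i with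
      | zero => exact ⟨h2, h3⟩
      | succ i => exact h4 i (by simpa using hi)
    · rintro ⟨h1, h2⟩
      have := h2 0 (by simp)
      rw [h0] at h1
      subst h1
      exact ⟨rfl, this.1, this.2, fun i hi => h2 (i + 1) (by simpa using hi)⟩

end Chain

/-! ### Homomorphisms of the knot group as labellings of the code -/

theorem coe_nextEdge (w : List Passage) (e : Fin w.length) :
    (nextEdge w e : ℕ) = if (e : ℕ) + 1 = w.length then 0 else (e : ℕ) + 1 := by
  unfold nextEdge
  generalize w.length = n at e
  cases n with
  | zero => exact e.elim0
  | succ n =>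
    rw [coe_finRotate]
    simp only [Fin.ext_iff, Fin.val_last, Nat.add_right_cancel_iff]

namespace KnotDiagram

variable {H : Type} [Group H] (D : KnotDiagram)

theorem labelled_map_fst {X : Type} (f : D.Arc → X) :
    (D.labelled f).map Prod.fst = D.code := by
  simp [labelled, List.map_ofFn, Function.comp_def]

theorem labelled_map {X Y : Type} (f : D.Arc → X) (g : X → Y) :
    (D.labelled f).map (Prod.map id g) = D.labelled fun i => g (f i) := by
  simp [labelled, List.map_ofFn, Function.comp_def]

theorem arc_nextEdge {e : D.Edge} (he : (D.code.get e).upper = true) :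
    D.arc (nextEdge D.code e) = D.arc e :=
  (Quot.sound ⟨he, rfl⟩).symm

theorem exists_edge_arc (i : D.Arc) : ∃ e, D.arc e = i := Quot.exists_rep i

theorem labelled_injective {X : Type} : Function.Injective (D.labelled (X := X)) := by
  intro f g h
  funext i
  obtain ⟨e, rfl⟩ := D.exists_edge_arc i
  have := congrFun (List.ofFn_injective h) e
  exact congrArg Prod.snd this

theorem edge_eq_of_crossing_eq {e o : D.Edge}
    (hc : (D.code.get e).crossing = (D.code.get o).crossing)
    (hu : (D.code.get e).upper = (D.code.get o).upper) : e = o := by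
  have h := List.nodup_iff_injective_get.mp D.nodup
  have h' : (⟨e, by simp⟩ : Fin (D.code.map fun p => (p.crossing, p.upper)).length) =
      ⟨o, by simp⟩ := h (by simpa using ⟨hc, hu⟩)
  simpa [Fin.ext_iff] using h'

theorem exists_upper {e : D.Edge} (he : (D.code.get e).upper = false) :
    ∃ o : D.Edge, (D.code.get o).upper = true ∧
      (D.code.get o).crossing = (D.code.get e).crossing := by
  have h := D.partner_mem _ (D.code.get_mem e)
  obtain ⟨o, ho⟩ := List.get_of_mem h
  exact ⟨o, by rw [ho]; simpa using he, by rw [ho]⟩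

theorem gen_nextEdge {e o : D.Edge} (he : (D.code.get e).upper = false)
    (ho : (D.code.get o).upper = true)
    (hc : (D.code.get e).crossing = (D.code.get o).crossing) :
    D.gen (D.arc (nextEdge D.code e)) = D.gen (D.arc o) ^ (-((D.code.get e).sign : ℤ)) *
      D.gen (D.arc e) * D.gen (D.arc o) ^ ((D.code.get e).sign : ℤ) := by
  have h := PresentedGroup.one_of_mem (rels := D.relators) ⟨e, o, he, ho, hc, rfl⟩
  simp only [map_mul, map_inv, map_zpow] at h
  rw [mul_assoc, mul_assoc, inv_mul_eq_one] at h
  rw [mul_assoc]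
  exact h

theorem gen_hom_ext {ρ σ : D.KnotGroup →* H}
    (h : D.labelled (fun i => ρ (D.gen i)) = D.labelled fun i => σ (D.gen i)) : ρ = σ :=
  PresentedGroup.ext fun i => congrFun (D.labelled_injective h) i

theorem isWirtingerLabelling_labelled (ρ : D.KnotGroup →* H) :
    IsWirtingerLabelling D.code (D.labelled fun i => ρ (D.gen i)) := by
  classical
  -- The upper label of a crossing is the image of the generator at its unique upper passage; the
  -- value 1 at numbers that name no crossing is irrelevant.
  refine ⟨D.labelled_map_fst _, fun c => if h : ∃ o : D.Edge, (D.code.get o).upper = true ∧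
    (D.code.get o).crossing = c then ρ (D.gen (D.arc h.choose)) else 1, ?_⟩
  have hpos : 0 < D.code.length := List.length_pos_iff.mpr D.code_ne_nil
  have hover (o : D.Edge) (ho : (D.code.get o).upper = true) :
      (if h : ∃ o' : D.Edge, (D.code.get o').upper = true ∧
        (D.code.get o').crossing = (D.code.get o).crossing then ρ (D.gen (D.arc h.choose)) else 1)
        = ρ (D.gen (D.arc o)) := by
    have h : ∃ o' : D.Edge, (D.code.get o').upper = true ∧
        (D.code.get o').crossing = (D.code.get o).crossing := ⟨o, ho, rfl⟩
    rw [dif_pos h, D.edge_eq_of_crossing_eq h.choose_spec.2 (h.choose_spec.1.trans ho.symm)]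
  set lab : ℕ → H := fun c => if h : ∃ o : D.Edge, (D.code.get o).upper = true ∧
    (D.code.get o).crossing = c then ρ (D.gen (D.arc h.choose)) else 1
  refine ⟨ρ (D.gen (D.arc ⟨0, hpos⟩)), wirtingerChain_iff.mpr ?_⟩
  have hlen : (D.labelled fun i => ρ (D.gen i)).length = D.code.length := by simp [labelled]
  have hlab (z : H) (e : D.Edge) :
      labelAt (D.labelled fun i => ρ (D.gen i)) z e = ρ (D.gen (D.arc e)) := by
    simp [labelAt, labelled]
  refine ⟨hlab _ ⟨0, hpos⟩, fun i hi => ?_⟩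
  rw [hlen] at hi
  have hget : (D.labelled fun i => ρ (D.gen i))[i].1 = D.code.get ⟨i, hi⟩ := by simp [labelled]
  rw [hget, hlab _ ⟨i, hi⟩]
  refine ⟨fun hu => hover _ hu, ?_⟩
  -- After the last passage `labelAt` returns its default, which was chosen as the label of edge 0;
  -- this is how the code closes up cyclically.
  have hnext : labelAt (D.labelled fun i => ρ (D.gen i)) (ρ (D.gen (D.arc ⟨0, hpos⟩))) (i + 1) =
      ρ (D.gen (D.arc (nextEdge D.code ⟨i, hi⟩))) := by
    have hc := coe_nextEdge D.code ⟨i, hi⟩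
    by_cases hl : i + 1 = D.code.length
    · have h0 : nextEdge D.code ⟨i, hi⟩ = ⟨0, hpos⟩ := Fin.ext (by simpa [hl] using hc)
      rw [h0]
      simp [labelAt, labelled, hl]
    · simp only [hl, if_false] at hc
      rw [← hc, hlab]
  rw [hnext, passageLabel]
  split_ifs with hu
  · rw [D.arc_nextEdge hu]
  · rw [Bool.not_eq_true] at hu
    obtain ⟨o, ho, hc⟩ := D.exists_upper hu
    have := hover o ho
    rw [D.gen_nextEdge hu ho hc.symm, ← hc]
    change _ = (lab _) ^ _ * _ * (lab _) ^ _
    rw [show lab _ = _ from this]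
    simp

/-- Upper passages leave the label unchanged, so edge labels descend to arcs; at a lower passage the
chain condition is exactly the Wirtinger relation. -/
theorem exists_hom_of_isWirtingerLabelling {L : List (Passage × H)}
    (hL : IsWirtingerLabelling D.code L) :
    ∃ ρ : D.KnotGroup →* H, D.labelled (fun i => ρ (D.gen i)) = L := by
  obtain ⟨hcode, lab, x, hch⟩ := hL
  obtain ⟨h0, hch⟩ := wirtingerChain_iff.mp hch
  have hlen : L.length = D.code.length := by rw [← hcode, List.length_map]
  have hget (e : D.Edge) : (L[e]'(by omega)).1 = D.code.get e := by
    simp [← hcode]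
  have hlab (e : D.Edge) : labelAt L x e = (L[e]'(by omega)).2 := by
    have : (e : ℕ) < L.length := by omega
    simp [labelAt, this]
  have hnext (e : D.Edge) : labelAt L x (e + 1) = labelAt L x (nextEdge D.code e) := by
    rw [coe_nextEdge]
    split_ifs with h
    · rw [h0]
      simp [labelAt, h, ← hlen]
    · rfl
  have hup (e : D.Edge) (he : (D.code.get e).upper = true) :
      lab (D.code.get e).crossing = labelAt L x e := by
    have := (hch e (by omega)).1
    rw [show L[(e : ℕ)].1 = _ from hget e] at this
    exact this he
  have hpass (e : D.Edge) : labelAt L x (nextEdge D.code e) =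
      passageLabel lab (D.code.get e) (labelAt L x e) := by
    rw [← hnext, (hch e (by omega)).2, show L[(e : ℕ)].1 = _ from hget e]
  let f : D.Arc → H := Quot.lift (fun e : D.Edge => labelAt L x e) (by
    rintro e _ ⟨he, rfl⟩
    rw [hpass, passageLabel, if_pos he])
  have hf : ∀ r ∈ D.relators, FreeGroup.lift f r = 1 := by
    rintro _ ⟨e, o, he, ho, hc, rfl⟩
    have h1 : f (D.arc (nextEdge D.code e)) = _ := hpass e
    have h2 : f (D.arc o) = _ := (hup o ho).symm
    have h3 : f (D.arc e) = labelAt L x e := rfl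
    simp only [map_mul, map_inv, map_zpow, FreeGroup.lift_apply_of]
    rw [h1, h2, h3, passageLabel, if_neg (by simpa using he), hc]
    group
  refine ⟨PresentedGroup.toGroup hf, ?_⟩
  refine List.ext_getElem (by simp [labelled, hlen]) fun i h1 h2 => ?_
  have hi : i < D.code.length := by omega
  have hi' : (PresentedGroup.toGroup hf) (D.gen (D.arc ⟨i, hi⟩)) = f (D.arc ⟨i, hi⟩) :=
    PresentedGroup.toGroup.of hf
  have hfe : f (D.arc ⟨i, hi⟩) = _ := hlab ⟨i, hi⟩
  rw [hfe] at hi'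
  have hg := hget ⟨i, hi⟩
  refine Prod.ext ?_ ?_
  · simp only [labelled, List.getElem_ofFn]
    exact hg.symm
  · simp only [labelled, List.getElem_ofFn]
    exact hi'

/-- A step that transfers the Wirtinger labellings of `D` bijectively and naturally to those of `D'`
induces an isomorphism of the knot groups. -/
theorem exists_isReidemeisterIso_of_transfer {D D' : KnotDiagram}
    (R : ∀ {X : Type}, List (Passage × X) → List (Passage × X) → Prop)
    (hstep : ∀ {X : Type} {L L' : List (Passage × X)}, R L L' → ReidemeisterStep L L')
    (hmap : ∀ {X Y : Type} (f : X → Y) {L L' : List (Passage × X)}, R L L' →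
      R (L.map (Prod.map id f)) (L'.map (Prod.map id f)))
    (hfwd : ∀ {H : Type} [Group H] (L : List (Passage × H)), IsWirtingerLabelling D.code L →
      ∃! L', IsWirtingerLabelling D'.code L' ∧ R L L')
    (hbwd : ∀ {H : Type} [Group H] (L' : List (Passage × H)), IsWirtingerLabelling D'.code L' →
      ∃! L, IsWirtingerLabelling D.code L ∧ R L L') :
    ∃ φ : D.KnotGroup ≃* D'.KnotGroup, IsReidemeisterIso φ := by
  -- Yoneda: transferring the tautological labelling by generators, in each direction, gives the two
  -- homomorphisms.
  obtain ⟨L', ⟨hL', hR'⟩, -⟩ := hfwd _ (D.isWirtingerLabelling_labelled (MonoidHom.id _))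
  obtain ⟨ψ, rfl⟩ := D'.exists_hom_of_isWirtingerLabelling hL'
  obtain ⟨L, ⟨hL, hR⟩, -⟩ := hbwd _ (D'.isWirtingerLabelling_labelled (MonoidHom.id _))
  obtain ⟨φ, rfl⟩ := D.exists_hom_of_isWirtingerLabelling hL
  have h1 := hmap φ hR'
  have h2 := hmap ψ hR
  simp only [labelled_map] at h1 h2
  -- By naturality the labellings of `D'` given by `φ.comp ψ` and by the identity are both transfers
  -- of the labelling `φ` of `D`, so uniqueness identifies them; likewise for `ψ.comp φ`.
  have e1 : φ.comp ψ = MonoidHom.id _ := D'.gen_hom_ext <|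
    (hfwd _ hL).unique ⟨D'.isWirtingerLabelling_labelled (φ.comp ψ), h1⟩
      ⟨D'.isWirtingerLabelling_labelled (MonoidHom.id _), hR⟩
  have e2 : ψ.comp φ = MonoidHom.id _ := D.gen_hom_ext <|
    (hbwd _ hL').unique ⟨D.isWirtingerLabelling_labelled (ψ.comp φ), h2⟩
      ⟨D.isWirtingerLabelling_labelled (MonoidHom.id _), hR'⟩
  exact ⟨φ.toMulEquiv ψ e2 e1, .step _ (hstep hR')⟩

end KnotDiagram

/-! ### Local computations: kink, pair of passages, triangle -/

section Strand

variable {H : Type} [Group H]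

theorem strand_map {X Y : Type} (f : X → Y) (o : ℤˣ) (p q : Passage) (x y : X) :
    (strand o p q x y).map (Prod.map id f) = strand o p q (f x) (f y) := by
  unfold strand
  split_ifs <;> rfl

theorem strand_map_fst {X Y : Type} (o : ℤˣ) (p q : Passage) (x y : X) (x' y' : Y) :
    (strand o p q x y).map Prod.fst = (strand o p q x' y').map Prod.fst := by
  unfold strand
  split_ifs <;> rfl

theorem strand_map_fst_perm {X : Type} (o : ℤˣ) (p q : Passage) (x y : X) :
    ((strand o p q x y).map Prod.fst).Perm [p, q] := by
  unfold strand
  split_ifs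
  · exact .refl _
  · exact .swap _ _ _

theorem exists_eq_strand {X Y : Type} {o : ℤˣ} {p q : Passage} {x y : Y} {L : List (Passage × X)}
    (h : L.map Prod.fst = (strand o p q x y).map Prod.fst) : ∃ x' y', L = strand o p q x' y' := by
  unfold strand at h ⊢
  split_ifs at h ⊢ <;> rcases L with _ | ⟨⟨r, s⟩, _ | ⟨⟨r', s'⟩, _ | ⟨_, _⟩⟩⟩ <;>
    simp_all

theorem strand_inj {X : Type} {o : ℤˣ} {p q : Passage} {x y x' y' : X}
    (h : strand o p q x y = strand o p q x' y') : x = x' ∧ y = y' := by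
  unfold strand at h
  split_ifs at h <;> simp_all

theorem WirtingerChain.comp {lab : ℕ → H} {f g : ℕ → ℕ} {L : List (Passage × H)}
    {x z : H} (h : WirtingerChain lab x L z) (hfg : ∀ n, g (f n) = n) :
    WirtingerChain (lab ∘ g) x
      (L.map fun p => (⟨f p.1.crossing, p.1.upper, p.1.sign⟩, p.2)) z := by
  induction L generalizing x with
  | nil => exact h
  | cons q L ih =>
    obtain ⟨h1, h2, h3⟩ := h
    refine ⟨h1, fun hu => by simpa [hfg] using h2 hu, ?_⟩
    convert ih h3 using 1
    simp [passageLabel, hfg]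

theorem wirtingerChain_of_comp {lab : ℕ → H} {f : ℕ → ℕ} {L : List (Passage × H)} {x z : H}
    (h : WirtingerChain lab x
      (L.map fun p => (⟨f p.1.crossing, p.1.upper, p.1.sign⟩, p.2)) z) :
    WirtingerChain (lab ∘ f) x L z := by
  induction L generalizing x with
  | nil => exact h
  | cons q L ih =>
    obtain ⟨h1, h2, h3⟩ := h
    exact ⟨h1, h2, ih h3⟩

/-- At a kink the strand passes under itself, so its label is conjugated by a power of itself; this
forces all labels to agree, whichever level comes first. -/
theorem wirtingerChain_kink {lab : ℕ → H} {c : ℕ} {b : Bool} {ε : ℤˣ} {s x y z : H} :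
    WirtingerChain lab s [(⟨c, b, ε⟩, x), (⟨c, !b, ε⟩, y)] z ↔
      x = s ∧ y = s ∧ lab c = s ∧ z = s := by
  cases b <;> simp only [WirtingerChain, passageLabel, Bool.not_true, Bool.not_false, if_true,
    Bool.false_eq_true, if_false, true_implies, false_implies, true_and]
  · constructor
    · rintro ⟨rfl, rfl, h, rfl⟩
      have hx : x = lab c := by
        have h' := h
        rw [mul_assoc, eq_comm, zpow_neg, inv_mul_eq_iff_eq_mul, (Commute.refl _).zpow_right _ |>.eq
          |> fun e => e.symm] at h'
        exact mul_right_cancel h'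
      subst hx
      refine ⟨rfl, ?_, rfl, ?_⟩ <;> group
    · rintro ⟨rfl, rfl, h, rfl⟩
      refine ⟨rfl, ?_, ?_, ?_⟩ <;> rw [h] <;> group
  · constructor
    · rintro ⟨rfl, h, rfl, h'⟩
      rw [h] at h'
      refine ⟨rfl, rfl, h, ?_⟩
      rw [← h']
      group
    · rintro ⟨rfl, rfl, h, rfl⟩
      refine ⟨rfl, h, rfl, ?_⟩
      rw [h]
      group

theorem wirtingerChain_strand {lab : ℕ → H} {o : ℤˣ} {p q : Passage} {s x y z : H} :
    WirtingerChain lab s (strand o p q x y) z ↔ x = s ∧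
      (o = 1 → (p.upper = true → lab p.crossing = s) ∧ y = passageLabel lab p s ∧
        (q.upper = true → lab q.crossing = y) ∧ z = passageLabel lab q y) ∧
      (o = -1 → (q.upper = true → lab q.crossing = s) ∧ y = passageLabel lab q s ∧
        (p.upper = true → lab p.crossing = y) ∧ z = passageLabel lab p y) := by
  have h1 : (1 : ℤˣ) ≠ -1 := by decide
  have h2 : (-1 : ℤˣ) ≠ 1 := by decide
  rcases Int.units_eq_one_or o with rfl | rfl <;>
    simp only [strand, if_true, h1, h2, if_false, false_implies, true_implies, true_and, and_true,
      WirtingerChain] <;> constructor <;> rintro ⟨rfl, h⟩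
  · obtain ⟨h3, rfl, h4, h5⟩ := h; exact ⟨rfl, h3, rfl, h4, h5.symm⟩
  · obtain ⟨h3, rfl, h4, h5⟩ := h; exact ⟨rfl, h3, rfl, h4, h5.symm⟩
  · obtain ⟨h3, rfl, h4, h5⟩ := h; exact ⟨rfl, h3, rfl, h4, h5.symm⟩
  · obtain ⟨h3, rfl, h4, h5⟩ := h; exact ⟨rfl, h3, rfl, h4, h5.symm⟩

theorem wirtingerChain_over {lab : ℕ → H} {o α β : ℤˣ} {a b : ℕ} {s x y z : H} :
    WirtingerChain lab s (strand o ⟨a, true, α⟩ ⟨b, true, β⟩ x y) z ↔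
      x = s ∧ y = s ∧ lab a = s ∧ lab b = s ∧ z = s := by
  rw [wirtingerChain_strand]
  have h1 : (1 : ℤˣ) ≠ -1 := by decide
  have h2 : (-1 : ℤˣ) ≠ 1 := by decide
  rcases Int.units_eq_one_or o with rfl | rfl <;>
    simp only [h1, h2, false_implies, true_implies, true_and, and_true, passageLabel, if_true] <;>
    constructor
  · rintro ⟨rfl, h1, rfl, h2, rfl⟩; exact ⟨rfl, rfl, h1, h2, rfl⟩
  · rintro ⟨rfl, rfl, h1, h2, rfl⟩; exact ⟨rfl, h1, rfl, h2, rfl⟩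
  · rintro ⟨rfl, h1, rfl, h2, rfl⟩; exact ⟨rfl, rfl, h2, h1, rfl⟩
  · rintro ⟨rfl, rfl, h1, h2, rfl⟩; exact ⟨rfl, h2, rfl, h1, rfl⟩

/-- The strands of a triangle have Wirtinger labels after a third move if they have such labels
before. Only the upper label of the lowest crossing changes. -/
theorem exists_triangle {lab : ℕ → H} {a b c : ℕ} (hac : a ≠ c) (hbc : b ≠ c) {α β γ δ : ℤˣ}
    {s₁ s₂ s₃ x₁ x₂ x₃ y₁ y₂ y₃ z₁ z₂ z₃ : H}
    (h₁ : WirtingerChain lab s₁ (strand (δ * α * β) ⟨a, true, α⟩ ⟨b, true, β⟩ x₁ y₁) z₁)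
    (h₂ : WirtingerChain lab s₂ (strand (δ * α * γ) ⟨a, false, α⟩ ⟨c, true, γ⟩ x₂ y₂) z₂)
    (h₃ : WirtingerChain lab s₃ (strand (δ * β * γ) ⟨b, false, β⟩ ⟨c, false, γ⟩ x₃ y₃) z₃) :
    ∃ k y₁' y₂' y₃',
      WirtingerChain (Function.update lab c k) s₁
        (strand (-δ * α * β) ⟨a, true, α⟩ ⟨b, true, β⟩ x₁ y₁') z₁ ∧
      WirtingerChain (Function.update lab c k) s₂
        (strand (-δ * α * γ) ⟨a, false, α⟩ ⟨c, true, γ⟩ x₂ y₂') z₂ ∧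
      WirtingerChain (Function.update lab c k) s₃
        (strand (-δ * β * γ) ⟨b, false, β⟩ ⟨c, false, γ⟩ x₃ y₃') z₃ := by
  have e1 : (1 : ℤˣ) ≠ -1 := by decide
  have e2 : (-1 : ℤˣ) ≠ 1 := by decide
  simp only [wirtingerChain_over] at h₁
  obtain ⟨rfl, rfl, ha, hb, rfl⟩ := h₁
  -- The label of the middle strand between its two crossings after the move. It is also the new
  -- upper label of `c`: if `a` comes first, the strand reaches `c` already conjugated by the top
  -- label `z₁`, otherwise it reaches `c` with its incoming label.
  let k : H := if -δ * α * γ = 1 then z₁ ^ (-(α : ℤ)) * x₂ * z₁ ^ (α : ℤ) else x₂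
  refine ⟨k, z₁, k, if -δ * β * γ = 1 then z₁ ^ (-(β : ℤ)) * x₃ * z₁ ^ (β : ℤ) else
    k ^ (-(γ : ℤ)) * x₃ * k ^ (γ : ℤ), ?_⟩
  simp only [wirtingerChain_strand, passageLabel, if_true, Bool.false_eq_true,
    if_false, false_implies, true_implies, true_and, Function.update_self,
    Function.update_of_ne hac, Function.update_of_ne hbc, ha, hb] at h₂ h₃ ⊢
  obtain ⟨rfl, h₂⟩ := h₂
  obtain ⟨rfl, h₃⟩ := h₃
  simp only [k]
  -- Fixing the signs fixes all orders of crossings. What remains is that conjugation by the top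
  -- label is an automorphism, so it respects conjugation of the bottom label by the middle one.
  rcases Int.units_eq_one_or α with rfl | rfl <;> rcases Int.units_eq_one_or β with rfl | rfl <;>
    rcases Int.units_eq_one_or γ with rfl | rfl <;> rcases Int.units_eq_one_or δ with rfl | rfl <;>
    simp only [mul_one, mul_neg, neg_neg, e1, e2, if_true, if_false, false_implies,
      true_implies, true_and, and_true] at h₂ h₃ ⊢ <;>
    obtain ⟨h₄, h₅⟩ := h₂ <;> obtain ⟨h₆, h₇⟩ := h₃ <;> (try obtain ⟨h₅, h₈⟩ := h₅) <;>
    subst_vars <;> simp_all <;> group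

/-- The incoming labels `x₁`, `x₂`, `x₃` determine the inner ones. The upper labels need not be
assumed equal, since they can be read off from strands 1 and 2. -/
theorem triangle_unique {lab lab' : ℕ → H} {a b c : ℕ} {o₁ o₂ o₃ : ℤˣ} {α β γ : ℤˣ}
    {s₁ s₂ s₃ s₁' s₂' s₃' x₁ x₂ x₃ y₁ y₂ y₃ y₁' y₂' y₃' z₁ z₂ z₃ z₁' z₂' z₃' : H}
    (h₁ : WirtingerChain lab s₁ (strand o₁ ⟨a, true, α⟩ ⟨b, true, β⟩ x₁ y₁) z₁)
    (h₂ : WirtingerChain lab s₂ (strand o₂ ⟨a, false, α⟩ ⟨c, true, γ⟩ x₂ y₂) z₂)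
    (h₃ : WirtingerChain lab s₃ (strand o₃ ⟨b, false, β⟩ ⟨c, false, γ⟩ x₃ y₃) z₃)
    (h₁' : WirtingerChain lab' s₁' (strand o₁ ⟨a, true, α⟩ ⟨b, true, β⟩ x₁ y₁') z₁')
    (h₂' : WirtingerChain lab' s₂' (strand o₂ ⟨a, false, α⟩ ⟨c, true, γ⟩ x₂ y₂') z₂')
    (h₃' : WirtingerChain lab' s₃' (strand o₃ ⟨b, false, β⟩ ⟨c, false, γ⟩ x₃ y₃') z₃') :
    y₁ = y₁' ∧ y₂ = y₂' ∧ y₃ = y₃' := by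
  have e1 : (1 : ℤˣ) ≠ -1 := by decide
  have e2 : (-1 : ℤˣ) ≠ 1 := by decide
  simp only [wirtingerChain_over] at h₁ h₁'
  obtain ⟨rfl, rfl, ha, hb, rfl⟩ := h₁
  obtain ⟨rfl, rfl, ha', hb', rfl⟩ := h₁'
  simp only [wirtingerChain_strand, passageLabel, if_true, Bool.false_eq_true,
    if_false, false_implies, true_implies, true_and, ha, hb, ha', hb'] at h₂ h₃ h₂' h₃'
  obtain ⟨rfl, h₂⟩ := h₂
  obtain ⟨rfl, h₃⟩ := h₃
  obtain ⟨rfl, h₂'⟩ := h₂'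
  obtain ⟨rfl, h₃'⟩ := h₃'
  refine ⟨rfl, ?_⟩
  rcases Int.units_eq_one_or o₂ with rfl | rfl <;> rcases Int.units_eq_one_or o₃ with rfl | rfl <;>
    simp only [e1, e2, false_implies, true_implies, true_and, and_true] at h₂ h₃ h₂' h₃' <;>
    simp_all

end Strand

/-! ### Splitting labelled codes and freeing upper labels -/

theorem append_inj_of_map_fst {X : Type} {L L' M M' : List (Passage × X)} {w : List Passage}
    (hL : L.map Prod.fst = w) (hL' : L'.map Prod.fst = w) (h : L ++ M = L' ++ M') :
    L = L' ∧ M = M' :=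
  List.append_inj h (by simpa using congrArg List.length (hL.trans hL'.symm))

theorem map_fst_map {X Y : Type} (f : X → Y) (L : List (Passage × X)) :
    (L.map (Prod.map id f)).map Prod.fst = L.map Prod.fst := by
  simp [Function.comp_def]

/-- A crossing is passed at most once on each level, so once both of its passages are split off, the
remainder avoids it. -/
theorem crossing_ne_of_nodup {w u : List Passage} {a : Passage} {s : ℤˣ}
    (hw : (w.map fun p => (p.crossing, p.upper)).Nodup)
    (hp : w.Perm (a :: ⟨a.crossing, !a.upper, s⟩ :: u)) : ∀ p ∈ u, p.crossing ≠ a.crossing := by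
  have h := (hp.map fun p => (p.crossing, p.upper)).nodup_iff.mp hw
  simp only [List.map_cons, List.nodup_cons, List.mem_cons, List.mem_map, not_or, not_exists,
    not_and, Prod.mk.injEq] at h
  intro p hp hc
  have h1 := h.1.2 p hp hc
  have h2 := h.2.1 p hp hc
  revert h1 h2
  cases p.upper <;> cases a.upper <;> simp

theorem WirtingerChain.update {H : Type} [Group H] {lab : ℕ → H} {c : ℕ} {L : List (Passage × H)}
    {x z : H} (h : WirtingerChain lab x L z) {w : List Passage} (hL : L.map Prod.fst = w)
    (hc : ∀ p ∈ w, p.crossing ≠ c) (k : H) : WirtingerChain (Function.update lab c k) x L z :=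
  h.congr fun q hq => Function.update_of_ne
    (hc q.1 (hL ▸ List.mem_map_of_mem hq)) _ _

/-! ### Isomorphisms for rotation, renaming, first and second moves -/

namespace KnotDiagram

variable {D D' : KnotDiagram}

theorem exists_isReidemeisterIso_rotate {u v : List Passage} (h : D.code = u ++ v)
    (h' : D'.code = v ++ u) : ∃ φ : D.KnotGroup ≃* D'.KnotGroup, IsReidemeisterIso φ := by
  -- Prescribing the passages of both pieces fixes the place of the cut; without this, a labelled
  -- list would have several rotations as partners.
  refine exists_isReidemeisterIso_of_transfer (fun L L' => ∃ U V, U.map Prod.fst = u ∧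
    V.map Prod.fst = v ∧ L = U ++ V ∧ L' = V ++ U) ?_ ?_ ?_ ?_
  · rintro X _ _ ⟨U, V, -, -, rfl, rfl⟩
    exact .rotate U V
  · rintro X Y f _ _ ⟨U, V, hU, hV, rfl, rfl⟩
    exact ⟨U.map (Prod.map id f), V.map (Prod.map id f), by rw [map_fst_map, hU],
      by rw [map_fst_map, hV], by simp, by simp⟩
  · rintro H _ L ⟨hL, lab, x, hch⟩
    obtain ⟨U, V, rfl, hU, hV⟩ := List.map_eq_append_iff.mp (hL.trans h)
    obtain ⟨y, h1, h2⟩ := wirtingerChain_append.mp hch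
    refine ⟨V ++ U, ⟨⟨by rw [List.map_append, hU, hV, h'], lab, y,
      wirtingerChain_append.mpr ⟨x, h2, h1⟩⟩, U, V, hU, hV, rfl, rfl⟩, ?_⟩
    rintro _ ⟨-, U', V', hU', hV', h3, rfl⟩
    obtain ⟨rfl, rfl⟩ := append_inj_of_map_fst hU hU' h3
    rfl
  · rintro H _ L ⟨hL, lab, x, hch⟩
    obtain ⟨V, U, rfl, hV, hU⟩ := List.map_eq_append_iff.mp (hL.trans h')
    obtain ⟨y, h1, h2⟩ := wirtingerChain_append.mp hch
    refine ⟨U ++ V, ⟨⟨by rw [List.map_append, hU, hV, h], lab, y,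
      wirtingerChain_append.mpr ⟨x, h2, h1⟩⟩, U, V, hU, hV, rfl, rfl⟩, ?_⟩
    rintro _ ⟨-, U', V', hU', hV', rfl, h3⟩
    obtain ⟨rfl, rfl⟩ := append_inj_of_map_fst hV hV' h3
    rfl

theorem exists_isReidemeisterIso_rename {f : ℕ → ℕ} (hf : Function.Injective f)
    (h : D'.code = D.code.map fun p => ⟨f p.crossing, p.upper, p.sign⟩) :
    ∃ φ : D.KnotGroup ≃* D'.KnotGroup, IsReidemeisterIso φ := by
  have hinj {X : Type} : Function.Injective fun L : List (Passage × X) =>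
      L.map fun p => ((⟨f p.1.crossing, p.1.upper, p.1.sign⟩ : Passage), p.2) := by
    refine List.map_injective_iff.mpr ?_
    rintro ⟨⟨c, b, s⟩, x⟩ ⟨⟨c', b', s'⟩, x'⟩ he
    simpa [hf.eq_iff] using he
  have hcode {X : Type} (L : List (Passage × X)) :
      (L.map fun p => ((⟨f p.1.crossing, p.1.upper, p.1.sign⟩ : Passage), p.2)).map Prod.fst =
        (L.map Prod.fst).map fun p => ⟨f p.crossing, p.upper, p.sign⟩ := by
    simp [Function.comp_def]
  refine exists_isReidemeisterIso_of_transfer (fun L L' =>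
    L' = L.map fun p => (⟨f p.1.crossing, p.1.upper, p.1.sign⟩, p.2)) ?_ ?_ ?_ ?_
  · rintro X L _ rfl
    exact .rename f hf L
  · rintro X Y g L _ rfl
    simp [Function.comp_def]
  · rintro H _ L ⟨hL, lab, x, hch⟩
    refine ⟨_, ⟨⟨by rw [hcode, hL, h], _, x, hch.comp (Function.leftInverse_invFun hf)⟩, rfl⟩, ?_⟩
    rintro _ ⟨-, rfl⟩
    rfl
  · rintro H _ L' ⟨hL, lab, x, hch⟩
    have hfst : ∃ L : List (Passage × H), L.map Prod.fst = D.code ∧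
        L' = L.map fun p => (⟨f p.1.crossing, p.1.upper, p.1.sign⟩, p.2) := by
      rw [h] at hL
      generalize D.code = w at hL
      clear hch
      induction L' generalizing w with
      | nil => exact ⟨[], (List.map_eq_nil_iff.mp hL.symm).symm, rfl⟩
      | cons q L' ih =>
        cases w with
        | nil => simp at hL
        | cons p w =>
          rw [List.map_cons, List.map_cons, List.cons.injEq] at hL
          obtain ⟨L, rfl, rfl⟩ := ih w hL.2
          exact ⟨(p, q.2) :: L, rfl, by rw [List.map_cons, ← hL.1]⟩
    obtain ⟨L, hL', rfl⟩ := hfst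
    refine ⟨L, ⟨⟨hL', _, x, wirtingerChain_of_comp hch⟩, rfl⟩, ?_⟩
    rintro M ⟨-, hM⟩
    exact (hinj hM).symm

theorem exists_isReidemeisterIso_first {c : ℕ} {b : Bool} {ε : ℤˣ}
    (h : D'.code = [⟨c, b, ε⟩, ⟨c, !b, ε⟩] ++ D.code) :
    ∃ φ : D.KnotGroup ≃* D'.KnotGroup, IsReidemeisterIso φ := by
  have hc : ∀ p ∈ D.code, p.crossing ≠ c :=
    crossing_ne_of_nodup (a := ⟨c, b, ε⟩) (s := ε) D'.nodup (by rw [h]; rfl)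
  refine exists_isReidemeisterIso_of_transfer (fun L L' => ∃ x y, L.map Prod.fst = D.code ∧
    L' = [(⟨c, b, ε⟩, x), (⟨c, !b, ε⟩, y)] ++ L) ?_ ?_ ?_ ?_
  · rintro X L _ ⟨x, y, -, rfl⟩
    exact .first c b ε x y L
  · rintro X Y f L _ ⟨x, y, hL, rfl⟩
    exact ⟨f x, f y, by rw [map_fst_map, hL], rfl⟩
  · rintro H _ L ⟨hL, lab, x, hch⟩
    refine ⟨[(⟨c, b, ε⟩, x), (⟨c, !b, ε⟩, x)] ++ L, ⟨⟨by simp [hL, h], Function.update lab c x, x,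
      wirtingerChain_append.mpr ⟨x, wirtingerChain_kink.mpr ⟨rfl, rfl, by simp, rfl⟩,
        hch.update hL hc x⟩⟩, x, x, hL, rfl⟩, ?_⟩
    rintro _ ⟨⟨-, lab', s, hch'⟩, x', y', -, rfl⟩
    obtain ⟨z, h1, h2⟩ := wirtingerChain_append.mp hch'
    obtain ⟨rfl, rfl, -, rfl⟩ := wirtingerChain_kink.mp h1
    -- The label of the kink is pinned down by the first edge of the old code, so that code must
    -- have one.
    have : L ≠ [] := by rintro rfl; exact D.code_ne_nil hL.symm
    obtain ⟨q, L, rfl⟩ := List.exists_cons_of_ne_nil this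
    rw [← h2.1, ← hch.1]
  · rintro H _ L' ⟨hL, lab, x, hch⟩
    obtain ⟨K, L, rfl, hK, hL₁⟩ := List.map_eq_append_iff.mp (hL.trans h)
    rcases K with _ | ⟨⟨p, x₁⟩, _ | ⟨⟨q, x₂⟩, _ | ⟨_, _⟩⟩⟩ <;> simp at hK
    obtain ⟨rfl, rfl⟩ := hK
    obtain ⟨z, h1, h2⟩ := wirtingerChain_append.mp hch
    obtain ⟨rfl, rfl, -, rfl⟩ := wirtingerChain_kink.mp h1
    refine ⟨L, ⟨⟨hL₁, lab, _, h2⟩, _, _, hL₁, rfl⟩, ?_⟩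
    rintro M ⟨-, _, _, hM, he⟩
    exact (List.append_inj he rfl).2.symm

theorem exists_isReidemeisterIso_second {c d : ℕ} {ε o : ℤˣ} {u v : List Passage}
    (h : D.code = u ++ v)
    (h' : D'.code = [⟨c, true, ε⟩, ⟨d, true, -ε⟩] ++ (u ++
      ((strand o ⟨c, false, ε⟩ ⟨d, false, -ε⟩ () ()).map Prod.fst ++ v))) :
    ∃ φ : D.KnotGroup ≃* D'.KnotGroup, IsReidemeisterIso φ := by
  classical
  have hst := strand_map_fst_perm o ⟨c, false, ε⟩ ⟨d, false, -ε⟩ () ()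
  have hc := crossing_ne_of_nodup (a := ⟨c, true, ε⟩) (s := ε)
    (u := ⟨d, true, -ε⟩ :: ⟨d, false, -ε⟩ :: (u ++ v)) D'.nodup (by
      rw [h']
      simp only [List.perm_iff_count, List.count_append, List.count_cons, List.count_nil,
        hst.count_eq, Bool.not_true]
      intro p
      omega)
  have hd := crossing_ne_of_nodup (a := ⟨d, true, -ε⟩) (s := -ε)
    (u := ⟨c, true, ε⟩ :: ⟨c, false, ε⟩ :: (u ++ v)) D'.nodup (by
      rw [h']
      simp only [List.perm_iff_count, List.count_append, List.count_cons, List.count_nil,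
        hst.count_eq, Bool.not_true]
      intro p
      omega)
  simp only [List.mem_cons, List.mem_append, forall_eq_or_imp] at hc hd
  have e1 : (1 : ℤˣ) ≠ -1 := by decide
  have e2 : (-1 : ℤˣ) ≠ 1 := by decide
  -- The two crossings have opposite signs and the same upper label, so the two conjugations cancel
  -- and the lower strand leaves with the label it entered with.
  have key {H : Type} [Group H] {lab : ℕ → H} {x y y₁ y₂ z : H} (hlc : lab c = x)
      (hld : lab d = x) (hs : WirtingerChain lab y
        (strand o ⟨c, false, ε⟩ ⟨d, false, -ε⟩ y₁ y₂) z) : z = y ∧ y₁ = y ∧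
        y₂ = if o = 1 then x ^ (-(ε : ℤ)) * y * x ^ (ε : ℤ)
          else x ^ (ε : ℤ) * y * x ^ (-(ε : ℤ)) := by
    rw [wirtingerChain_strand] at hs
    rcases Int.units_eq_one_or o with rfl | rfl <;>
    simp only [passageLabel, Bool.false_eq_true, if_false, false_implies, true_implies, true_and,
      hlc, hld, e1, e2, and_true, if_true, Units.val_neg, neg_neg] at hs ⊢ <;>
    obtain ⟨rfl, rfl, rfl⟩ := hs <;> refine ⟨?_, rfl, rfl⟩ <;> group
  have key' {H : Type} [Group H] {lab : ℕ → H} {x y : H} (hlc : lab c = x)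
      (hld : lab d = x) : ∃ y₂, WirtingerChain lab y
        (strand o ⟨c, false, ε⟩ ⟨d, false, -ε⟩ y y₂) y := by
    refine ⟨if o = 1 then x ^ (-(ε : ℤ)) * y * x ^ (ε : ℤ)
          else x ^ (ε : ℤ) * y * x ^ (-(ε : ℤ)), ?_⟩
    rw [wirtingerChain_strand]
    rcases Int.units_eq_one_or o with rfl | rfl <;>
    simp only [passageLabel, Bool.false_eq_true, if_false, false_implies, true_implies, true_and,
      hlc, hld, e1, e2, and_true, if_true, Units.val_neg, neg_neg] <;> group
  refine exists_isReidemeisterIso_of_transfer (fun L L' => ∃ x x' y y' U V, U.map Prod.fst = u ∧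
    V.map Prod.fst = v ∧ L = U ++ V ∧ L' = [(⟨c, true, ε⟩, x), (⟨d, true, -ε⟩, x')] ++ (U ++
      (strand o ⟨c, false, ε⟩ ⟨d, false, -ε⟩ y y' ++ V))) ?_ ?_ ?_ ?_
  · rintro X L _ ⟨x, x', y, y', U, V, -, -, rfl, rfl⟩
    simpa only [List.append_assoc] using ReidemeisterStep.second c d ε o x x' y y' U V
  · rintro X Y f L _ ⟨x, x', y, y', U, V, hU, hV, rfl, rfl⟩
    exact ⟨f x, f x', f y, f y', U.map (Prod.map id f), V.map (Prod.map id f),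
      by rw [map_fst_map, hU], by rw [map_fst_map, hV], by simp, by simp [strand_map]⟩
  · rintro H _ L ⟨hL, lab, x, hch⟩
    obtain ⟨U, V, rfl, hU, hV⟩ := List.map_eq_append_iff.mp (hL.trans h)
    obtain ⟨y, h1, h2⟩ := wirtingerChain_append.mp hch
    set lab' := Function.update (Function.update lab c x) d x with hlab'
    have hlc : lab' c = x := by simp [hlab', Function.update_of_ne hd.1]
    have hld : lab' d = x := by simp [hlab']
    have hu : WirtingerChain lab' x U y :=
      (h1.update hU (fun p hp => hc.2.2 p (.inl hp)) x).update hU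
        (fun p hp => hd.2.2 p (.inl hp)) x
    have hv : WirtingerChain lab' y V x :=
      (h2.update hV (fun p hp => hc.2.2 p (.inr hp)) x).update hV
        (fun p hp => hd.2.2 p (.inr hp)) x
    obtain ⟨y₂, hy₂⟩ := key' (y := y) hlc hld
    refine ⟨_, ⟨⟨?_, lab', x, wirtingerChain_append.mpr ⟨x, ?_, wirtingerChain_append.mpr
      ⟨y, hu, wirtingerChain_append.mpr ⟨y, hy₂, hv⟩⟩⟩⟩, x, x, y, y₂, U, V, hU, hV, rfl, rfl⟩, ?_⟩
    · simp only [List.map_append, hU, hV, h', strand_map_fst o _ _ y y₂ () ()]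
      rfl
    · simp [WirtingerChain, passageLabel, hlc, hld]
    · rintro _ ⟨⟨-, lab₂, s, hch₂⟩, x₁, x₂, y₁, y₃, U', V', hU', hV', h3, rfl⟩
      obtain ⟨rfl, rfl⟩ := append_inj_of_map_fst hU hU' h3
      obtain ⟨t, h4, h5⟩ := wirtingerChain_append.mp hch₂
      obtain ⟨t', h6, h7⟩ := wirtingerChain_append.mp h5
      obtain ⟨t'', h8, h9⟩ := wirtingerChain_append.mp h7
      simp only [WirtingerChain, passageLabel, if_true, true_implies] at h4
      obtain ⟨rfl, h10, rfl, h11, rfl⟩ := h4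
      obtain ⟨rfl, rfl, h12⟩ := key h10 h11 h8
      obtain ⟨-, -, h13⟩ := key hlc hld hy₂
      have hUV : U ++ V ≠ [] := by rintro he; exact D.code_ne_nil (by rw [← hL, he]; rfl)
      have h14 := wirtingerChain_append.mpr ⟨_, h6, h9⟩
      have hx : x₂ = x := by
        obtain ⟨q, L, hq⟩ := List.exists_cons_of_ne_nil hUV
        rw [hq] at hch h14
        rw [← h14.1, ← hch.1]
      subst hx
      -- If `V` is empty there is no later edge to compare with, but the lower strand then runs into
      -- the start of the code, where the label is already known.
      have hy : y₁ = y := by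
        cases V with
        | nil =>
          exact h9.trans h2.symm
        | cons q V => rw [← h9.1, ← h2.1]
      subst hy
      rw [h12, h13]
  · rintro H _ L' ⟨hL, lab, x, hch⟩
    obtain ⟨K, L, rfl, hK, hL₁⟩ := List.map_eq_append_iff.mp (hL.trans h')
    rcases K with _ | ⟨⟨p, x₁⟩, _ | ⟨⟨q, x₂⟩, _ | ⟨_, _⟩⟩⟩ <;> simp at hK
    obtain ⟨rfl, rfl⟩ := hK
    obtain ⟨U, M, rfl, hU, hM⟩ := List.map_eq_append_iff.mp hL₁
    obtain ⟨S, V, rfl, hS, hV⟩ := List.map_eq_append_iff.mp hM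
    obtain ⟨y₁, y₂, rfl⟩ := exists_eq_strand hS
    obtain ⟨t, h4, h5⟩ := wirtingerChain_append.mp hch
    obtain ⟨t', h6, h7⟩ := wirtingerChain_append.mp h5
    obtain ⟨t'', h8, h9⟩ := wirtingerChain_append.mp h7
    simp only [WirtingerChain, passageLabel, if_true, true_implies] at h4
    obtain ⟨rfl, h10, rfl, h11, rfl⟩ := h4
    obtain ⟨rfl, rfl, h12⟩ := key h10 h11 h8
    refine ⟨U ++ V, ⟨⟨by simp [hU, hV, h], lab, _, wirtingerChain_append.mpr ⟨_, h6, h9⟩⟩,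
      _, _, _, _, U, V, hU, hV, rfl, rfl⟩, ?_⟩
    rintro _ ⟨-, x₁, x₃, y₁, y₃, U', V', hU', hV', rfl, h3⟩
    obtain ⟨-, h3⟩ := List.append_inj h3 rfl
    obtain ⟨rfl, h13⟩ := append_inj_of_map_fst hU hU' h3
    obtain ⟨-, rfl⟩ := append_inj_of_map_fst (strand_map_fst _ _ _ _ _ () ())
      (strand_map_fst _ _ _ _ _ () ()) h13
    rfl

end KnotDiagram

/-! ### Isomorphisms for third moves -/

namespace KnotDiagram

variable {D D' : KnotDiagram}

/-- A pair of codes, with labels, before and after a third move on strands that one meets in the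
order 1, 2, 3. -/
def ThirdMove (a b c : ℕ) (α β γ δ : ℤˣ) (u v w : List Passage) {X : Type}
    (L L' : List (Passage × X)) : Prop :=
  ∃ (x₁ y₁ y₁' x₂ y₂ y₂' x₃ y₃ y₃' : X) (U V W : List (Passage × X)),
    U.map Prod.fst = u ∧ V.map Prod.fst = v ∧ W.map Prod.fst = w ∧
    L = strand (δ * α * β) ⟨a, true, α⟩ ⟨b, true, β⟩ x₁ y₁ ++ (U ++
      (strand (δ * α * γ) ⟨a, false, α⟩ ⟨c, true, γ⟩ x₂ y₂ ++ (V ++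
      (strand (δ * β * γ) ⟨b, false, β⟩ ⟨c, false, γ⟩ x₃ y₃ ++ W)))) ∧
    L' = strand (-δ * α * β) ⟨a, true, α⟩ ⟨b, true, β⟩ x₁ y₁' ++ (U ++
      (strand (-δ * α * γ) ⟨a, false, α⟩ ⟨c, true, γ⟩ x₂ y₂' ++ (V ++
      (strand (-δ * β * γ) ⟨b, false, β⟩ ⟨c, false, γ⟩ x₃ y₃' ++ W))))

/-- A pair of codes, with labels, before and after a third move on strands that one meets in the
order 1, 3, 2. -/
def ThirdMove' (a b c : ℕ) (α β γ δ : ℤˣ) (u v w : List Passage) {X : Type}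
    (L L' : List (Passage × X)) : Prop :=
  ∃ (x₁ y₁ y₁' x₂ y₂ y₂' x₃ y₃ y₃' : X) (U V W : List (Passage × X)),
    U.map Prod.fst = u ∧ V.map Prod.fst = v ∧ W.map Prod.fst = w ∧
    L = strand (δ * α * β) ⟨a, true, α⟩ ⟨b, true, β⟩ x₁ y₁ ++ (U ++
      (strand (δ * β * γ) ⟨b, false, β⟩ ⟨c, false, γ⟩ x₃ y₃ ++ (V ++
      (strand (δ * α * γ) ⟨a, false, α⟩ ⟨c, true, γ⟩ x₂ y₂ ++ W)))) ∧
    L' = strand (-δ * α * β) ⟨a, true, α⟩ ⟨b, true, β⟩ x₁ y₁' ++ (U ++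
      (strand (-δ * β * γ) ⟨b, false, β⟩ ⟨c, false, γ⟩ x₃ y₃' ++ (V ++
      (strand (-δ * α * γ) ⟨a, false, α⟩ ⟨c, true, γ⟩ x₂ y₂' ++ W))))

section

variable {a b c : ℕ} {α β γ δ : ℤˣ} {u v w : List Passage} {X Y : Type} {L L' : List (Passage × X)}

/-- The third move is its own inverse up to the sign of `δ`, so only the forward transfer has to be
proved. -/
theorem ThirdMove.symm (h : ThirdMove a b c α β γ δ u v w L L') :
    ThirdMove a b c α β γ (-δ) u v w L' L := by
  obtain ⟨x₁, y₁, y₁', x₂, y₂, y₂', x₃, y₃, y₃', U, V, W, hU, hV, hW, rfl, rfl⟩ := h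
  exact ⟨x₁, y₁', y₁, x₂, y₂', y₂, x₃, y₃', y₃, U, V, W, hU, hV, hW, rfl, by rw [neg_neg]⟩

theorem ThirdMove'.symm (h : ThirdMove' a b c α β γ δ u v w L L') :
    ThirdMove' a b c α β γ (-δ) u v w L' L := by
  obtain ⟨x₁, y₁, y₁', x₂, y₂, y₂', x₃, y₃, y₃', U, V, W, hU, hV, hW, rfl, rfl⟩ := h
  exact ⟨x₁, y₁', y₁, x₂, y₂', y₂, x₃, y₃', y₃, U, V, W, hU, hV, hW, rfl, by rw [neg_neg]⟩

theorem ThirdMove.map (f : X → Y) (h : ThirdMove a b c α β γ δ u v w L L') :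
    ThirdMove a b c α β γ δ u v w (L.map (Prod.map id f)) (L'.map (Prod.map id f)) := by
  obtain ⟨x₁, y₁, y₁', x₂, y₂, y₂', x₃, y₃, y₃', U, V, W, hU, hV, hW, rfl, rfl⟩ := h
  refine ⟨f x₁, f y₁, f y₁', f x₂, f y₂, f y₂', f x₃, f y₃, f y₃', U.map (Prod.map id f),
    V.map (Prod.map id f), W.map (Prod.map id f), ?_⟩
  simp only [map_fst_map, hU, hV, hW, List.map_append, strand_map, true_and]

theorem ThirdMove'.map (f : X → Y) (h : ThirdMove' a b c α β γ δ u v w L L') :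
    ThirdMove' a b c α β γ δ u v w (L.map (Prod.map id f)) (L'.map (Prod.map id f)) := by
  obtain ⟨x₁, y₁, y₁', x₂, y₂, y₂', x₃, y₃, y₃', U, V, W, hU, hV, hW, rfl, rfl⟩ := h
  refine ⟨f x₁, f y₁, f y₁', f x₂, f y₂, f y₂', f x₃, f y₃, f y₃', U.map (Prod.map id f),
    V.map (Prod.map id f), W.map (Prod.map id f), ?_⟩
  simp only [map_fst_map, hU, hV, hW, List.map_append, strand_map, true_and]

end

section

variable {a b c : ℕ} {α β γ δ : ℤˣ} {u v w : List Passage} {H : Type} [Group H]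

/-- Since `exists_triangle` keeps the labels entering and leaving the triangle, the outer pieces
carry over; they avoid `c`, the only crossing whose upper label changes. Uniqueness is local, by
`triangle_unique`. -/
theorem ThirdMove.existsUnique
    (h : D.code = (strand (δ * α * β) ⟨a, true, α⟩ ⟨b, true, β⟩ () ()).map Prod.fst ++ (u ++
      ((strand (δ * α * γ) ⟨a, false, α⟩ ⟨c, true, γ⟩ () ()).map Prod.fst ++ (v ++
      ((strand (δ * β * γ) ⟨b, false, β⟩ ⟨c, false, γ⟩ () ()).map Prod.fst ++ w)))))
    (h' : D'.code = (strand (-δ * α * β) ⟨a, true, α⟩ ⟨b, true, β⟩ () ()).map Prod.fst ++ (u ++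
      ((strand (-δ * α * γ) ⟨a, false, α⟩ ⟨c, true, γ⟩ () ()).map Prod.fst ++ (v ++
      ((strand (-δ * β * γ) ⟨b, false, β⟩ ⟨c, false, γ⟩ () ()).map Prod.fst ++ w)))))
    {L : List (Passage × H)} (hL : IsWirtingerLabelling D.code L) :
    ∃! L', IsWirtingerLabelling D'.code L' ∧ ThirdMove a b c α β γ δ u v w L L' := by
  classical
  have hc := crossing_ne_of_nodup (a := ⟨c, true, γ⟩) (s := γ)
    (u := ⟨a, true, α⟩ :: ⟨b, true, β⟩ :: ⟨a, false, α⟩ :: ⟨b, false, β⟩ :: (u ++ (v ++ w)))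
    D.nodup (by
      rw [h]
      simp only [List.perm_iff_count, List.count_append, List.count_cons, List.count_nil,
        (strand_map_fst_perm _ _ _ _ _).count_eq, Bool.not_true]
      intro p
      omega)
  simp only [List.mem_cons, List.mem_append, forall_eq_or_imp] at hc
  obtain ⟨hac, hbc, -, -, hc⟩ := hc
  obtain ⟨hL, lab, x, hch⟩ := hL
  rw [h] at hL
  obtain ⟨S, M, rfl, hS, hL⟩ := List.map_eq_append_iff.mp hL
  obtain ⟨U, M, rfl, hU, hL⟩ := List.map_eq_append_iff.mp hL
  obtain ⟨T, M, rfl, hT, hL⟩ := List.map_eq_append_iff.mp hL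
  obtain ⟨V, M, rfl, hV, hL⟩ := List.map_eq_append_iff.mp hL
  obtain ⟨R, W, rfl, hR, hW⟩ := List.map_eq_append_iff.mp hL
  obtain ⟨x₁, y₁, rfl⟩ := exists_eq_strand hS
  obtain ⟨x₂, y₂, rfl⟩ := exists_eq_strand hT
  obtain ⟨x₃, y₃, rfl⟩ := exists_eq_strand hR
  simp only [wirtingerChain_append] at hch
  obtain ⟨s₁, h₁, s₂, hu, s₃, h₂, s₄, hv, s₅, h₃, hw⟩ := hch
  obtain ⟨k, y₁', y₂', y₃', h₁', h₂', h₃'⟩ := exists_triangle hac hbc h₁ h₂ h₃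
  refine ⟨_, ⟨⟨?_, Function.update lab c k, x, ?_⟩, x₁, y₁, y₁', x₂, y₂, y₂', x₃, y₃, y₃', U, V, W,
    hU, hV, hW, rfl, rfl⟩, ?_⟩
  · simp only [List.map_append, hU, hV, hW, h', strand_map_fst _ _ _ _ _ () ()]
  · simp only [wirtingerChain_append]
    exact ⟨s₁, h₁', s₂, hu.update hU (fun p hp => hc p (.inl hp)) k, s₃, h₂', s₄,
      hv.update hV (fun p hp => hc p (.inr (.inl hp))) k, s₅, h₃',
      hw.update hW (fun p hp => hc p (.inr (.inr hp))) k⟩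
  · rintro _ ⟨⟨-, lab', t, hch'⟩, x₁', _, z₁, x₂', _, z₂, x₃', _, z₃, U', V', W', hU', hV', hW',
      he, rfl⟩
    obtain ⟨e₁, he⟩ := append_inj_of_map_fst hS (strand_map_fst _ _ _ _ _ () ()) he
    obtain ⟨rfl, he₂⟩ := append_inj_of_map_fst hU hU' he
    obtain ⟨e₂, he⟩ := append_inj_of_map_fst hT (strand_map_fst _ _ _ _ _ () ()) he₂
    obtain ⟨rfl, he₃⟩ := append_inj_of_map_fst hV hV' he
    obtain ⟨e₃, rfl⟩ := append_inj_of_map_fst hR (strand_map_fst _ _ _ _ _ () ()) he₃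
    obtain ⟨rfl, -⟩ := strand_inj e₁
    obtain ⟨rfl, -⟩ := strand_inj e₂
    obtain ⟨rfl, -⟩ := strand_inj e₃
    simp only [wirtingerChain_append] at hch'
    obtain ⟨t₁, h₁'', t₂, -, t₃, h₂'', t₄, -, t₅, h₃'', -⟩ := hch'
    obtain ⟨rfl, rfl, rfl⟩ := triangle_unique h₁' h₂' h₃' h₁'' h₂'' h₃''
    rfl

theorem ThirdMove'.existsUnique
    (h : D.code = (strand (δ * α * β) ⟨a, true, α⟩ ⟨b, true, β⟩ () ()).map Prod.fst ++ (u ++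
      ((strand (δ * β * γ) ⟨b, false, β⟩ ⟨c, false, γ⟩ () ()).map Prod.fst ++ (v ++
      ((strand (δ * α * γ) ⟨a, false, α⟩ ⟨c, true, γ⟩ () ()).map Prod.fst ++ w)))))
    (h' : D'.code = (strand (-δ * α * β) ⟨a, true, α⟩ ⟨b, true, β⟩ () ()).map Prod.fst ++ (u ++
      ((strand (-δ * β * γ) ⟨b, false, β⟩ ⟨c, false, γ⟩ () ()).map Prod.fst ++ (v ++
      ((strand (-δ * α * γ) ⟨a, false, α⟩ ⟨c, true, γ⟩ () ()).map Prod.fst ++ w)))))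
    {L : List (Passage × H)} (hL : IsWirtingerLabelling D.code L) :
    ∃! L', IsWirtingerLabelling D'.code L' ∧ ThirdMove' a b c α β γ δ u v w L L' := by
  classical
  have hc := crossing_ne_of_nodup (a := ⟨c, true, γ⟩) (s := γ)
    (u := ⟨a, true, α⟩ :: ⟨b, true, β⟩ :: ⟨a, false, α⟩ :: ⟨b, false, β⟩ :: (u ++ (v ++ w)))
    D.nodup (by
      rw [h]
      simp only [List.perm_iff_count, List.count_append, List.count_cons, List.count_nil,
        (strand_map_fst_perm _ _ _ _ _).count_eq, Bool.not_true]
      intro p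
      omega)
  simp only [List.mem_cons, List.mem_append, forall_eq_or_imp] at hc
  obtain ⟨hac, hbc, -, -, hc⟩ := hc
  obtain ⟨hL, lab, x, hch⟩ := hL
  rw [h] at hL
  obtain ⟨S, M, rfl, hS, hL⟩ := List.map_eq_append_iff.mp hL
  obtain ⟨U, M, rfl, hU, hL⟩ := List.map_eq_append_iff.mp hL
  obtain ⟨R, M, rfl, hR, hL⟩ := List.map_eq_append_iff.mp hL
  obtain ⟨V, M, rfl, hV, hL⟩ := List.map_eq_append_iff.mp hL
  obtain ⟨T, W, rfl, hT, hW⟩ := List.map_eq_append_iff.mp hL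
  obtain ⟨x₁, y₁, rfl⟩ := exists_eq_strand hS
  obtain ⟨x₂, y₂, rfl⟩ := exists_eq_strand hT
  obtain ⟨x₃, y₃, rfl⟩ := exists_eq_strand hR
  simp only [wirtingerChain_append] at hch
  obtain ⟨s₁, h₁, s₂, hu, s₃, h₃, s₄, hv, s₅, h₂, hw⟩ := hch
  obtain ⟨k, y₁', y₂', y₃', h₁', h₂', h₃'⟩ := exists_triangle hac hbc h₁ h₂ h₃
  refine ⟨_, ⟨⟨?_, Function.update lab c k, x, ?_⟩, x₁, y₁, y₁', x₂, y₂, y₂', x₃, y₃, y₃', U, V, W,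
    hU, hV, hW, rfl, rfl⟩, ?_⟩
  · simp only [List.map_append, hU, hV, hW, h', strand_map_fst _ _ _ _ _ () ()]
  · simp only [wirtingerChain_append]
    exact ⟨s₁, h₁', s₂, hu.update hU (fun p hp => hc p (.inl hp)) k, s₃, h₃', s₄,
      hv.update hV (fun p hp => hc p (.inr (.inl hp))) k, s₅, h₂',
      hw.update hW (fun p hp => hc p (.inr (.inr hp))) k⟩
  · rintro _ ⟨⟨-, lab', t, hch'⟩, x₁', _, z₁, x₂', _, z₂, x₃', _, z₃, U', V', W', hU', hV', hW',
      he, rfl⟩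
    obtain ⟨e₁, he⟩ := append_inj_of_map_fst hS (strand_map_fst _ _ _ _ _ () ()) he
    obtain ⟨rfl, he₂⟩ := append_inj_of_map_fst hU hU' he
    obtain ⟨e₃, he⟩ := append_inj_of_map_fst hR (strand_map_fst _ _ _ _ _ () ()) he₂
    obtain ⟨rfl, he₃⟩ := append_inj_of_map_fst hV hV' he
    obtain ⟨e₂, rfl⟩ := append_inj_of_map_fst hT (strand_map_fst _ _ _ _ _ () ()) he₃
    obtain ⟨rfl, -⟩ := strand_inj e₁
    obtain ⟨rfl, -⟩ := strand_inj e₂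
    obtain ⟨rfl, -⟩ := strand_inj e₃
    simp only [wirtingerChain_append] at hch'
    obtain ⟨t₁, h₁'', t₂, -, t₃, h₃'', t₄, -, t₅, h₂'', -⟩ := hch'
    obtain ⟨rfl, rfl, rfl⟩ := triangle_unique h₁' h₂' h₃' h₁'' h₂'' h₃''
    rfl

theorem exists_isReidemeisterIso_third
    (h : D.code = (strand (δ * α * β) ⟨a, true, α⟩ ⟨b, true, β⟩ () ()).map Prod.fst ++ (u ++
      ((strand (δ * α * γ) ⟨a, false, α⟩ ⟨c, true, γ⟩ () ()).map Prod.fst ++ (v ++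
      ((strand (δ * β * γ) ⟨b, false, β⟩ ⟨c, false, γ⟩ () ()).map Prod.fst ++ w)))))
    (h' : D'.code = (strand (-δ * α * β) ⟨a, true, α⟩ ⟨b, true, β⟩ () ()).map Prod.fst ++ (u ++
      ((strand (-δ * α * γ) ⟨a, false, α⟩ ⟨c, true, γ⟩ () ()).map Prod.fst ++ (v ++
      ((strand (-δ * β * γ) ⟨b, false, β⟩ ⟨c, false, γ⟩ () ()).map Prod.fst ++ w))))) :
    ∃ φ : D.KnotGroup ≃* D'.KnotGroup, IsReidemeisterIso φ := by
  refine exists_isReidemeisterIso_of_transfer (ThirdMove a b c α β γ δ u v w) ?_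
    (fun f _ _ hR => hR.map f) (fun L hL => ThirdMove.existsUnique h h' hL) (fun L' hL' => ?_)
  · rintro X _ _ ⟨x₁, y₁, y₁', x₂, y₂, y₂', x₃, y₃, y₃', U, V, W, -, -, -, rfl, rfl⟩
    simpa only [List.append_assoc] using
      ReidemeisterStep.third a b c α β γ δ x₁ y₁ y₁' x₂ y₂ y₂' x₃ y₃ y₃' U V W
  · obtain ⟨L, ⟨hL, hR⟩, hu⟩ :=
      ThirdMove.existsUnique (δ := -δ) h' (by rw [neg_neg, h]) hL'
    exact ⟨L, ⟨hL, by simpa using hR.symm⟩, fun M hM => hu M ⟨hM.1, hM.2.symm⟩⟩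

theorem exists_isReidemeisterIso_third'
    (h : D.code = (strand (δ * α * β) ⟨a, true, α⟩ ⟨b, true, β⟩ () ()).map Prod.fst ++ (u ++
      ((strand (δ * β * γ) ⟨b, false, β⟩ ⟨c, false, γ⟩ () ()).map Prod.fst ++ (v ++
      ((strand (δ * α * γ) ⟨a, false, α⟩ ⟨c, true, γ⟩ () ()).map Prod.fst ++ w)))))
    (h' : D'.code = (strand (-δ * α * β) ⟨a, true, α⟩ ⟨b, true, β⟩ () ()).map Prod.fst ++ (u ++
      ((strand (-δ * β * γ) ⟨b, false, β⟩ ⟨c, false, γ⟩ () ()).map Prod.fst ++ (v ++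
      ((strand (-δ * α * γ) ⟨a, false, α⟩ ⟨c, true, γ⟩ () ()).map Prod.fst ++ w))))) :
    ∃ φ : D.KnotGroup ≃* D'.KnotGroup, IsReidemeisterIso φ := by
  refine exists_isReidemeisterIso_of_transfer (ThirdMove' a b c α β γ δ u v w) ?_
    (fun f _ _ hR => hR.map f) (fun L hL => ThirdMove'.existsUnique h h' hL) (fun L' hL' => ?_)
  · rintro X _ _ ⟨x₁, y₁, y₁', x₂, y₂, y₂', x₃, y₃, y₃', U, V, W, -, -, -, rfl, rfl⟩
    simpa only [List.append_assoc] using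
      ReidemeisterStep.third' a b c α β γ δ x₁ y₁ y₁' x₂ y₂ y₂' x₃ y₃ y₃' U V W
  · obtain ⟨L, ⟨hL, hR⟩, hu⟩ :=
      ThirdMove'.existsUnique (δ := -δ) h' (by rw [neg_neg, h]) hL'
    exact ⟨L, ⟨hL, by simpa using hR.symm⟩, fun M hM => hu M ⟨hM.1, hM.2.symm⟩⟩

end

/-! ### Isomorphisms for sequences of moves -/

/-- Only the codes underlying the step enter, so the trivial labels in `SameKnot` suffice to produce
an isomorphism compatible with generators. -/
theorem exists_isReidemeisterIso_of_step {X : Type} {f : D.Arc → X} {f' : D'.Arc → X}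
    (h : ReidemeisterStep (D.labelled f) (D'.labelled f')) :
    ∃ φ : D.KnotGroup ≃* D'.KnotGroup, IsReidemeisterIso φ := by
  have hD := D.labelled_map_fst f
  have hD' := D'.labelled_map_fst f'
  generalize D.labelled f = L at h hD
  generalize D'.labelled f' = L' at h hD'
  cases h with
  | rotate u v =>
    rw [List.map_append] at hD hD'
    exact exists_isReidemeisterIso_rotate hD.symm hD'.symm
  | rename g hg =>
    refine exists_isReidemeisterIso_rename hg ?_
    rw [← hD', ← hD]
    simp [Function.comp_def]
  | first c b ε x y =>
    refine exists_isReidemeisterIso_first (c := c) (b := b) (ε := ε) ?_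
    rw [← hD', ← hD]
    rfl
  | second c d ε o x x' y y' u v =>
    refine exists_isReidemeisterIso_second (c := c) (d := d) (ε := ε) (o := o)
      (u := u.map Prod.fst) (v := v.map Prod.fst) ?_ ?_
    · rw [← hD, List.map_append]
    · simp only [← hD', List.map_append, List.append_assoc, strand_map_fst _ _ _ _ _ () ()]
      rfl
  | third a b c α β γ δ x y y' x₂ y₂ y₂' x₃ y₃ y₃' u v w =>
    refine exists_isReidemeisterIso_third (a := a) (b := b) (c := c) (α := α) (β := β) (γ := γ)
      (δ := δ) (u := u.map Prod.fst) (v := v.map Prod.fst) (w := w.map Prod.fst) ?_ ?_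
    · simp only [← hD, List.map_append, List.append_assoc, strand_map_fst _ _ _ _ _ () ()]
    · simp only [← hD', List.map_append, List.append_assoc, strand_map_fst _ _ _ _ _ () ()]
  | third' a b c α β γ δ x y y' x₂ y₂ y₂' x₃ y₃ y₃' u v w =>
    refine exists_isReidemeisterIso_third' (a := a) (b := b) (c := c) (α := α) (β := β) (γ := γ)
      (δ := δ) (u := u.map Prod.fst) (v := v.map Prod.fst) (w := w.map Prod.fst) ?_ ?_
    · simp only [← hD, List.map_append, List.append_assoc, strand_map_fst _ _ _ _ _ () ()]
    · simp only [← hD', List.map_append, List.append_assoc, strand_map_fst _ _ _ _ _ () ()]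

theorem SameKnot.exists_isReidemeisterIso (h : D.SameKnot D') :
    ∃ φ : D.KnotGroup ≃* D'.KnotGroup, IsReidemeisterIso φ := by
  induction h with
  | rel D D' h => exact exists_isReidemeisterIso_of_step h
  | refl D => exact ⟨_, .refl D⟩
  | symm D D' _ ih =>
    obtain ⟨φ, hφ⟩ := ih
    exact ⟨_, .symm φ hφ⟩
  | trans D D' D'' _ _ ih₁ ih₂ =>
    obtain ⟨φ, hφ⟩ := ih₁
    obtain ⟨ψ, hψ⟩ := ih₂
    exact ⟨_, .trans φ ψ hφ hψ⟩

end KnotDiagram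

/-! ### Meridians are preserved -/

/-- With labels in the knot group, this yields one generator that the isomorphism sends to a
generator. In a third move, the edge that enters the top strand of the triangle survives. -/
theorem ReidemeisterStep.exists_common_label {X : Type} {L L' : List (Passage × X)}
    (h : ReidemeisterStep L L') (hL : L ≠ []) : ∃ p ∈ L, ∃ p' ∈ L', p.2 = p'.2 := by
  have key {o o' : ℤˣ} {p q : Passage} {x y y' : X} :
      ∃ r ∈ strand o p q x y, ∃ r' ∈ strand o' p q x y', r.2 = r'.2 := by
    unfold strand
    split_ifs <;> simp
  cases h with
  | rotate u v =>
    obtain ⟨p, hp⟩ := List.exists_mem_of_ne_nil _ hL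
    exact ⟨p, hp, p, by simpa [or_comm] using hp, rfl⟩
  | rename f =>
    obtain ⟨p, hp⟩ := List.exists_mem_of_ne_nil _ hL
    exact ⟨p, hp, _, List.mem_map_of_mem hp, rfl⟩
  | first =>
    obtain ⟨p, hp⟩ := List.exists_mem_of_ne_nil _ hL
    exact ⟨p, hp, p, by simp [hp], rfl⟩
  | second c d ε o x x' y y' u v =>
    obtain ⟨p, hp⟩ := List.exists_mem_of_ne_nil _ hL
    refine ⟨p, hp, p, ?_, rfl⟩
    rw [List.mem_append] at hp
    simp only [List.mem_append]
    tauto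
  | third a b c α β γ δ x y y' =>
    obtain ⟨r, hr, r', hr', he⟩ := key (o := δ * α * β) (o' := -δ * α * β) (p := ⟨a, true, α⟩)
      (q := ⟨b, true, β⟩) (x := x) (y := y) (y' := y')
    exact ⟨r, by simp [hr], r', by simp only [List.mem_append, hr', true_or], he⟩
  | third' a b c α β γ δ x y y' =>
    obtain ⟨r, hr, r', hr', he⟩ := key (o := δ * α * β) (o' := -δ * α * β) (p := ⟨a, true, α⟩)
      (q := ⟨b, true, β⟩) (x := x) (y := y) (y' := y')
    exact ⟨r, by simp [hr], r', by simp only [List.mem_append, hr', true_or], he⟩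

namespace KnotDiagram

variable {D D' : KnotDiagram}

theorem isConj_gen_nextEdge (D : KnotDiagram) (e : D.Edge) :
    IsConj (D.gen (D.arc e)) (D.gen (D.arc (nextEdge D.code e))) := by
  by_cases he : (D.code.get e).upper = true
  · rw [D.arc_nextEdge he]
  · rw [Bool.not_eq_true] at he
    obtain ⟨o, ho, hc⟩ := D.exists_upper he
    rw [D.gen_nextEdge he ho hc.symm, isConj_iff]
    exact ⟨_, by rw [zpow_neg, inv_inv]⟩

/-- A knot has one component: running along the code reaches every edge, and each passage conjugates
the generator or leaves it alone. -/
theorem isConj_gen (D : KnotDiagram) (i j : D.Arc) : IsConj (D.gen i) (D.gen j) := by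
  have hpos : 0 < D.code.length := List.length_pos_iff.mpr D.code_ne_nil
  have key (k : ℕ) (hk : k < D.code.length) :
      IsConj (D.gen (D.arc ⟨0, hpos⟩)) (D.gen (D.arc ⟨k, hk⟩)) := by
    induction k with
    | zero => exact IsConj.refl _
    | succ k ih =>
      have hn : nextEdge D.code ⟨k, by omega⟩ = ⟨k + 1, hk⟩ :=
        Fin.ext (by rw [coe_nextEdge, if_neg (by simpa using hk.ne)])
      exact (ih (by omega)).trans (hn ▸ D.isConj_gen_nextEdge ⟨k, by omega⟩)
  obtain ⟨e, rfl⟩ := D.exists_edge_arc i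
  obtain ⟨e', rfl⟩ := D.exists_edge_arc j
  exact (key e e.2).symm.trans (key e' e'.2)

theorem isMeridian_iff (i : D.Arc) {m : D.KnotGroup} : D.IsMeridian m ↔ IsConj (D.gen i) m :=
  ⟨fun ⟨j, hj⟩ => (D.isConj_gen i j).trans hj, fun h => ⟨i, h⟩⟩

/-- The meridians on each side form a single conjugacy class, so for a single move one matching pair
of generators is enough. -/
theorem IsReidemeisterIso.isMeridian_iff {φ : D.KnotGroup ≃* D'.KnotGroup}
    (hφ : IsReidemeisterIso φ) (m : D.KnotGroup) : D'.IsMeridian (φ m) ↔ D.IsMeridian m := by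
  induction hφ with
  | refl D => rfl
  | @step D D' φ h =>
    have hL : D.labelled D.gen ≠ [] := by
      simpa [labelled, List.ofFn_eq_nil_iff] using D.code_ne_nil
    obtain ⟨p, hp, p', hp', he⟩ := h.exists_common_label hL
    obtain ⟨e, rfl⟩ := List.mem_ofFn.mp hp
    obtain ⟨e', rfl⟩ := List.mem_ofFn.mp hp'
    have he : φ (D.gen (D.arc e)) = D'.gen (D'.arc e') := φ.eq_symm_apply.mp he
    rw [KnotDiagram.isMeridian_iff (D'.arc e'), KnotDiagram.isMeridian_iff (D.arc e), ← he]
    refine ⟨fun hc => ?_, fun hc => φ.toMonoidHom.map_isConj hc⟩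
    simpa using φ.symm.toMonoidHom.map_isConj hc
  | symm φ _ ih => rw [← ih, φ.apply_symm_apply]
  | trans φ ψ _ _ ih₁ ih₂ => exact (ih₂ _).trans (ih₁ m)

end KnotDiagram

/-! ### Vectors in the plane and transvections -/

open Matrix

/-- The determinant of two vectors in the plane. -/
def vectorDet (v w : Fin 2 → ℂ) : ℂ := v 0 * w 1 - w 0 * v 1

theorem vectorDet_neg_left (v w : Fin 2 → ℂ) : vectorDet (-v) w = -vectorDet v w := by
  simp only [vectorDet, Pi.neg_apply]
  ring

theorem vectorDet_neg_right (v w : Fin 2 → ℂ) : vectorDet v (-w) = -vectorDet v w := by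
  simp only [vectorDet, Pi.neg_apply]
  ring

theorem vectorDet_mulVec (g : Matrix.SpecialLinearGroup (Fin 2) ℂ) (v w : Fin 2 → ℂ) :
    vectorDet (g.1 *ᵥ v) (g.1 *ᵥ w) = vectorDet v w := by
  have hg := g.2
  rw [det_fin_two] at hg
  simp only [vectorDet, mulVec, dotProduct, Fin.sum_univ_two]
  linear_combination (v 0 * w 1 - w 0 * v 1) * hg

/-- This exhibits the matrix as a transvection along `v`, with a determinant as coefficient; the
field argument rests on this form. -/
theorem parabolicMatrix_mulVec (v w : Fin 2 → ℂ) :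
    parabolicMatrix v *ᵥ w = w + vectorDet v w • v := by
  ext i
  fin_cases i <;> simp [parabolicMatrix, vectorDet, mulVec, dotProduct, Fin.sum_univ_two] <;> ring

/-- Since `g` preserves determinants, it carries the transvection along `v` to the one along `g v`.
The entries are compared after multiplying by `g` on the right, which avoids the inverse. -/
theorem parabolicMatrix_conj (g : Matrix.SpecialLinearGroup (Fin 2) ℂ) (v : Fin 2 → ℂ) :
    parabolicMatrix (g.1 *ᵥ v) = g.1 * parabolicMatrix v * (g⁻¹).1 := by
  have hinv : g.1 * (g⁻¹).1 = 1 := by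
    rw [← Matrix.SpecialLinearGroup.coe_mul, mul_inv_cancel, Matrix.SpecialLinearGroup.coe_one]
  have h : parabolicMatrix (g.1 *ᵥ v) * g.1 = g.1 * parabolicMatrix v := by
    have hg := g.2
    rw [det_fin_two] at hg
    ext i j
    fin_cases i <;> fin_cases j <;>
      simp [parabolicMatrix, mulVec, dotProduct, Matrix.mul_apply, Fin.sum_univ_two]
    · linear_combination (-v 1) * (g.1 0 0 * v 0 + g.1 0 1 * v 1) * hg
    · linear_combination v 0 * (g.1 0 0 * v 0 + g.1 0 1 * v 1) * hg
    · linear_combination (-v 1) * (g.1 1 0 * v 0 + g.1 1 1 * v 1) * hg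
    · linear_combination v 0 * (g.1 1 0 * v 0 + g.1 1 1 * v 1) * hg
  rw [← h, Matrix.mul_assoc, hinv, Matrix.mul_one]

/-- The off-diagonal entries give each coordinate up to sign, and the diagonal gives the product,
which excludes mixed signs unless a coordinate vanishes. -/
theorem eq_or_eq_neg_of_parabolicMatrix_eq {v w : Fin 2 → ℂ}
    (h : parabolicMatrix v = parabolicMatrix w) : v = w ∨ v = -w := by
  have h00 : 1 - v 0 * v 1 = 1 - w 0 * w 1 := congrFun (congrFun h 0) 0
  have h01 : v 0 ^ 2 = w 0 ^ 2 := congrFun (congrFun h 0) 1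
  have h10 : -v 1 ^ 2 = -w 1 ^ 2 := congrFun (congrFun h 1) 0
  have hp : v 0 * v 1 = w 0 * w 1 := by linear_combination -h00
  rcases sq_eq_sq_iff_eq_or_eq_neg.mp h01 with h0 | h0 <;>
    rcases sq_eq_sq_iff_eq_or_eq_neg.mp (neg_injective h10) with h1 | h1
  · exact .inl (by ext i; fin_cases i <;> assumption)
  · rw [h0, h1] at hp
    have hz : w 0 * w 1 = 0 := by linear_combination -hp / 2
    rcases mul_eq_zero.mp hz with hz | hz
    · exact .inr (by ext i; fin_cases i <;> simp [h0, h1, hz])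
    · exact .inl (by ext i; fin_cases i <;> simp [h0, h1, hz])
  · rw [h0, h1] at hp
    have hz : w 0 * w 1 = 0 := by linear_combination -hp / 2
    rcases mul_eq_zero.mp hz with hz | hz
    · exact .inl (by ext i; fin_cases i <;> simp [h0, h1, hz])
    · exact .inr (by ext i; fin_cases i <;> simp [h0, h1, hz])
  · exact .inr (by ext i; fin_cases i <;> assumption)

/-! ### The field generated by all meridian vectors -/

namespace KnotDiagram

variable {D D' : KnotDiagram}

/-- The vectors that color the meridians in a representation of the knot group. -/
def meridianVectors (D : KnotDiagram) (ρ : D.KnotGroup →* Matrix.SpecialLinearGroup (Fin 2) ℂ) :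
    Set (Fin 2 → ℂ) :=
  {v | ∃ m, D.IsMeridian m ∧ parabolicMatrix v = (ρ m).1}

theorem uValue_eq_vectorDet (a : D.Arc → Fin 2 → ℂ) (i j : D.Arc) :
    D.uValue a i j = vectorDet (a i) (a j) := by
  rw [uValue, det_fin_two_of, vectorDet]

theorem vectorDet_mem_uField (a : D.Arc → Fin 2 → ℂ) (i j : D.Arc) :
    vectorDet (a i) (a j) ∈ D.uField a :=
  IntermediateField.subset_adjoin _ _ ⟨(i, j), uValue_eq_vectorDet a i j⟩

section

variable {ρ : D.KnotGroup →* Matrix.SpecialLinearGroup (Fin 2) ℂ} {a : D.Arc → Fin 2 → ℂ}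

/-- A generator `k` adds `det(a_k, v) det(a_i, a_k)` to `det(a_i, v)`. The new term involves the arc
`k`, so the hypothesis must cover all arcs at once to be stable under the group. -/
theorem IsArcColoring.vectorDet_mulVec_mem_uField (ha : D.IsArcColoring ρ a) (g : D.KnotGroup)
    {v : Fin 2 → ℂ} (hv : ∀ i, vectorDet (a i) v ∈ D.uField a) (i : D.Arc) :
    vectorDet (a i) ((ρ g).1 *ᵥ v) ∈ D.uField a := by
  -- The claim for `g⁻¹` is carried along, so that the inverse step of the induction just swaps the
  -- two halves.
  suffices h : (∀ v, (∀ i, vectorDet (a i) v ∈ D.uField a) →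
      ∀ i, vectorDet (a i) ((ρ g).1 *ᵥ v) ∈ D.uField a) ∧
      (∀ v, (∀ i, vectorDet (a i) v ∈ D.uField a) →
      ∀ i, vectorDet (a i) ((ρ g⁻¹).1 *ᵥ v) ∈ D.uField a) from h.1 v hv i
  clear hv v i
  have hg : g ∈ Subgroup.closure (Set.range (PresentedGroup.of (rels := D.relators))) := by
    rw [PresentedGroup.closure_range_of]
    trivial
  induction hg using Subgroup.closure_induction with
  | mem _ h =>
    obtain ⟨k, rfl⟩ := h
    have hk : (ρ (D.gen k)).1 = parabolicMatrix (a k) := (ha k).symm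
    refine ⟨fun v hv i => ?_, fun v hv i => ?_⟩
    · change vectorDet (a i) ((ρ (D.gen k)).1 *ᵥ v) ∈ _
      have : vectorDet (a i) (parabolicMatrix (a k) *ᵥ v) =
          vectorDet (a i) v + vectorDet (a k) v * vectorDet (a i) (a k) := by
        rw [parabolicMatrix_mulVec]
        simp only [vectorDet, Pi.add_apply, Pi.smul_apply, smul_eq_mul]
        ring
      rw [hk, this]
      exact add_mem (hv i) (mul_mem (hv k) (vectorDet_mem_uField a i k))
    · change vectorDet (a i) ((ρ (D.gen k)⁻¹).1 *ᵥ v) ∈ _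
      -- The inverse transvection subtracts the same multiple, because `det(a_k, a_k) = 0`.
      have hinv : (ρ (D.gen k)⁻¹).1 *ᵥ v = v - vectorDet (a k) v • a k := by
        have h1 : v = (ρ (D.gen k)).1 *ᵥ (v - vectorDet (a k) v • a k) := by
          rw [hk, parabolicMatrix_mulVec]
          ext j
          simp only [vectorDet, Pi.add_apply, Pi.sub_apply, Pi.smul_apply, smul_eq_mul]
          ring
        conv_lhs => rw [h1]
        rw [mulVec_mulVec, ← Matrix.SpecialLinearGroup.coe_mul, ← map_mul, inv_mul_cancel, map_one,
          Matrix.SpecialLinearGroup.coe_one, one_mulVec]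
      have : vectorDet (a i) (v - vectorDet (a k) v • a k) =
          vectorDet (a i) v - vectorDet (a k) v * vectorDet (a i) (a k) := by
        simp only [vectorDet, Pi.sub_apply, Pi.smul_apply, smul_eq_mul]
        ring
      rw [hinv, this]
      exact sub_mem (hv i) (mul_mem (hv k) (vectorDet_mem_uField a i k))
  | one => simp
  | mul g h _ _ ihg ihh =>
    refine ⟨fun v hv i => ?_, fun v hv i => ?_⟩
    · rw [map_mul, Matrix.SpecialLinearGroup.coe_mul, ← mulVec_mulVec]
      exact ihg.1 _ (ihh.1 _ hv) i
    · rw [_root_.mul_inv_rev, map_mul, Matrix.SpecialLinearGroup.coe_mul, ← mulVec_mulVec]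
      exact ihh.2 _ (ihg.2 _ hv) i
  | inv g _ ih => exact ⟨ih.2, by rw [inv_inv]; exact ih.1⟩

/-- A meridian is `g` times a generator times `g⁻¹`, so `ρ(g) a_i` is one vector that colors it, and
the only other is its negative. -/
theorem IsArcColoring.exists_of_mem_meridianVectors (ha : D.IsArcColoring ρ a) {v : Fin 2 → ℂ}
    (hv : v ∈ D.meridianVectors ρ) :
    ∃ (g : D.KnotGroup) (i : D.Arc), v = (ρ g).1 *ᵥ a i ∨ v = -((ρ g).1 *ᵥ a i) := by
  obtain ⟨m, ⟨i, hm⟩, hv⟩ := hv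
  obtain ⟨g, rfl⟩ := isConj_iff.mp hm
  refine ⟨g, i, eq_or_eq_neg_of_parabolicMatrix_eq ?_⟩
  rw [hv, parabolicMatrix_conj, ha i]
  simp only [map_mul, map_inv]
  rfl

/-- The `u`-field does not depend on the diagram, but only on the representation and the meridians. -/
theorem IsArcColoring.uField_eq (ha : D.IsArcColoring ρ a) :
    D.uField a = IntermediateField.adjoin ℚ
      {z | ∃ v ∈ D.meridianVectors ρ, ∃ w ∈ D.meridianVectors ρ, z = vectorDet v w} := by
  refine le_antisymm ?_ ?_
  · refine IntermediateField.adjoin.mono _ _ _ ?_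
    rintro _ ⟨⟨i, j⟩, rfl⟩
    exact ⟨a i, ⟨_, ⟨i, IsConj.refl _⟩, ha i⟩, a j, ⟨_, ⟨j, IsConj.refl _⟩, ha j⟩,
      uValue_eq_vectorDet a i j⟩
  · rw [IntermediateField.adjoin_le_iff]
    rintro _ ⟨v, hv, w, hw, rfl⟩
    obtain ⟨g, i, hv⟩ := ha.exists_of_mem_meridianVectors hv
    obtain ⟨h, j, hw⟩ := ha.exists_of_mem_meridianVectors hw
    have key : vectorDet ((ρ g).1 *ᵥ a i) ((ρ h).1 *ᵥ a j) ∈ D.uField a := by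
      -- Factoring out `ρ(g)` on both sides, invariance of the determinant leaves `det(a_i, ρ(g⁻¹h)
      -- a_j)`, with an arc vector on the left.
      have : (ρ h).1 *ᵥ a j = (ρ g).1 *ᵥ ((ρ (g⁻¹ * h)).1 *ᵥ a j) := by
        rw [mulVec_mulVec, ← Matrix.SpecialLinearGroup.coe_mul, ← map_mul, mul_inv_cancel_left]
      rw [this, vectorDet_mulVec]
      exact ha.vectorDet_mulVec_mem_uField _ (fun k => vectorDet_mem_uField a k j) i
    rcases hv with rfl | rfl <;> rcases hw with rfl | rfl <;>
      simpa only [vectorDet_neg_left, vectorDet_neg_right, neg_neg, neg_mem_iff, SetLike.mem_coe]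
        using key

end

theorem IsReidemeisterIso.meridianVectors_comp {φ : D.KnotGroup ≃* D'.KnotGroup}
    (hφ : IsReidemeisterIso φ) (ρ : D'.KnotGroup →* Matrix.SpecialLinearGroup (Fin 2) ℂ) :
    D.meridianVectors (ρ.comp φ.toMonoidHom) = D'.meridianVectors ρ := by
  ext v
  constructor
  · rintro ⟨m, hm, hv⟩
    exact ⟨φ m, (hφ.isMeridian_iff m).mpr hm, hv⟩
  · rintro ⟨m, hm, hv⟩
    refine ⟨φ.symm m, (hφ.isMeridian_iff _).mp (by rwa [φ.apply_symm_apply]), ?_⟩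
    rw [hv]
    simp

end KnotDiagram

theorem mainTheorem6 (D D' : KnotDiagram) (hK : D.SameKnot D') :
    (∃ φ : D.KnotGroup ≃* D'.KnotGroup, KnotDiagram.IsReidemeisterIso φ) ∧
    ∀ φ : D.KnotGroup ≃* D'.KnotGroup, KnotDiagram.IsReidemeisterIso φ →
      ∀ ρ : D'.KnotGroup →* Matrix.SpecialLinearGroup (Fin 2) ℂ, D'.IsParabolic ρ →
        ∀ (a : D.Arc → Fin 2 → ℂ) (a' : D'.Arc → Fin 2 → ℂ),
          D.IsArcColoring (ρ.comp φ.toMonoidHom) a → D'.IsArcColoring ρ a' →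
            D.uField a = D'.uField a' := by
  refine ⟨hK.exists_isReidemeisterIso, fun φ hφ ρ _ a a' ha ha' => ?_⟩
  rw [ha.uField_eq, ha'.uField_eq, hφ.meridianVectors_comp]
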